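/- Let $p$ be a prime number. For $y\in\mathbb{R}$ let $\|y\|$ denote the distance from $y$ to the nearest integer. Let $x=[a_0;a_1,a_2,\ldots]\in\mathbb{R}$ be a counterexample to the $p$-adic Littlewood conjecture, i.e. $\liminf_{q\to\infty} q\cdot|q|_p\cdot\|qx\|\neq 0$ (such an $x$ is irrational). Let $w_{CF}(x)=a_1a_2a_3\ldots\in\mathbb{N}^{\mathbb{N}}$ be the infinite word of partial quotients of $x$, let $\mathrm{T}$ be the left shift on $\mathbb{N}^{\mathbb{N}}$, and let $\mathcal{W}_{CF}(x)$ be the set of limit points of the sequence $(\mathrm{T}^n w_{CF}(x))_{n\in\mathbb{N}}$ in the product topology ($\mathbb{N}$ being discrete). For an infinite word $w$ let $P(w,n)$ be the number of distinct blocks of length $n$ occurring in $w$. Then for every $w\in\mathcal{W}_{CF}(x)$, $$\lim_{n\to\infty}\bigl(P(w,n)-n\bigr)=\infty .$$ In particular, $\mathcal{W}_{CF}(x)$ contains no Sturmian word, i.e. no word $w$ with $P(w,n)=n+1$ for all $n\ge 0$. -/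

import Mathlib

open Filter Topology

namespace PLC

/-- The distance `‖y‖` from a real number to the nearest integer. -/
noncomputable def distInt (y : ℝ) : ℝ := |y - round y|

/-- `x` is a counterexample to the `p`-adic Littlewood conjecture:
`liminf_{q → ∞} q * |q|_p * ‖q x‖` is not zero. (The sequence is nonnegative, and it has
infinitely many terms `≤ 1` by Dirichlet's theorem, so this real `liminf` is the genuine one.) -/
def IsCounterexample (p : ℕ) [Fact p.Prime] (x : ℝ) : Prop :=
  liminf (fun q : ℕ => (q : ℝ) * ‖(q : ℚ_[p])‖ * distInt ((q : ℝ) * x)) atTop ≠ 0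

/-- The infinite word `a₁ a₂ a₃ …` of partial quotients of `x = [a₀; a₁, a₂, a₃, …]`; the letter
with index `n` is `a_{n+1}`. For rational `x` the expansion is finite and is padded with zeros;
no counterexample to the conjecture is rational. -/
noncomputable def cfWord (x : ℝ) : ℕ → ℕ :=
  fun n => ⌊((GenContFract.of x).partDens.get? n).getD 0⌋₊

/-- The `n`-th iterate `T^n` of the left shift on infinite words. -/
def shift (n : ℕ) (w : ℕ → ℕ) : ℕ → ℕ := fun i => w (n + i)

/-- The limit points of the sequence `T^n (cfWord x)`, in the product topology on `ℕ → ℕ`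
coming from the discrete topology on the letters. -/
def limitWords (x : ℝ) : Set (ℕ → ℕ) :=
  {w | MapClusterPt w atTop (fun n : ℕ => shift n (cfWord x))}

/-- The set of blocks (factors) of length `n` occurring in `w`. -/
def factors (w : ℕ → ℕ) (n : ℕ) : Set (Fin n → ℕ) :=
  Set.range fun i : ℕ => fun j : Fin n => w (i + j)

/-- The word complexity `P(w, n)`: the number of distinct blocks of length `n` occurring in `w`. -/
noncomputable def complexity (w : ℕ → ℕ) (n : ℕ) : ℕ := (factors w n).ncard

/-- A Sturmian word: exactly `n + 1` blocks of each length `n`. -/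
def IsSturmian (w : ℕ → ℕ) : Prop := ∀ n : ℕ, complexity w n = n + 1

end PLC

/-!
Suppose that `P(w, n) - n` is bounded for a limit word `w`. No period persists over long stretches
of `w`, so `P(w, n + 1) = P(w, n) + 1` for all large `n`: eventually `w` has exactly one right
special block of each length, followed by just two letters, and `w` is a concatenation of the two
return words `u` and `v` of such a block. Let `A` and `B` be the products of the continued fraction
matrices along `u` and `v`. Modulo any `q`, the products along the prefixes of `w` fill a whole
coset of the finite group generated by `A` and `B`, because the set of products recurring at the
right special positions shrinks to a set which both return words must preserve. Hence for every `E`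
some denominator vector `(qₙ, qₙ₋₁)` of `x` is, modulo a high power of `p`, carried by all powers
of `A` and of `B` to denominator vectors of `x` at arbitrarily late positions.

Being a counterexample bounds these orbits: by Thue's lemma there is a short integral form
vanishing at the vector to a high power of `p`, and along the powers of a matrix `γ ≡ 1 (mod p²)`
its values are essentially affine in the exponent, so some value is much more divisible by `p` than
the inequality `c ≤ q |q|_p ‖q x‖` allows, unless the vector is nearly an eigenvector of `γ`. So
suitable powers of `A` and `B` have a common eigenvector modulo every power of `p`, and their
commutator `γ δ - δ γ` has determinant `0`. But these powers are hyperbolic, with irrational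
eigenvalues, and do not commute, since `u` and `v` start with different letters.
-/

namespace PLC

section Words

variable {α : Type*} {w : ℕ → α} {N M d i j k : ℕ}

/-- The blocks of length `N` of the word `w` starting at the positions `i` and `j` coincide. -/
def Agree (w : ℕ → α) (N i j : ℕ) : Prop := ∀ k < N, w (i + k) = w (j + k)

theorem agree_succ : Agree w (N + 1) i j ↔ Agree w N i j ∧ w (i + N) = w (j + N) := by
  simp only [Agree, Nat.forall_lt_succ_right]

theorem Agree.tail (h : Agree w (N + 1) i j) : Agree w N (i + 1) (j + 1) := fun k hk => by
  simpa only [add_assoc, add_comm 1 k] using h (k + 1) (Nat.succ_lt_succ hk)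

theorem agree_iff_factor_eq :
    Agree w N i j ↔ (fun k : Fin N => w (i + k)) = fun k : Fin N => w (j + k) :=
  ⟨fun h => funext fun k => h k k.2, fun h k hk => congrFun h ⟨k, hk⟩⟩

/-- The blocks of length `N` of `w` that end just before the positions `i` and `j` coincide. -/
def AgreeLeft (w : ℕ → α) (N i j : ℕ) : Prop :=
  N ≤ i ∧ N ≤ j ∧ ∀ k, 1 ≤ k → k ≤ N → w (i - k) = w (j - k)

theorem AgreeLeft.symm (h : AgreeLeft w N i j) : AgreeLeft w N j i :=
  ⟨h.2.1, h.1, fun k hk hkN => (h.2.2 k hk hkN).symm⟩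

theorem AgreeLeft.trans (h : AgreeLeft w N i j) (h' : AgreeLeft w N j k) : AgreeLeft w N i k :=
  ⟨h.1, h'.2.1, fun l hl hlN => (h.2.2 l hl hlN).trans (h'.2.2 l hl hlN)⟩

theorem AgreeLeft.mono (h : AgreeLeft w M i j) (hNM : N ≤ M) : AgreeLeft w N i j :=
  ⟨hNM.trans h.1, hNM.trans h.2.1, fun k hk hkN => h.2.2 k hk (hkN.trans hNM)⟩

theorem agreeLeft_succ :
    AgreeLeft w (N + 1) (i + 1) (j + 1) ↔ AgreeLeft w N i j ∧ w i = w j := by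
  constructor
  · rintro ⟨hi, hj, h⟩
    refine ⟨⟨by omega, by omega, fun k hk hkN => ?_⟩, h 1 le_rfl (by omega)⟩
    simpa only [Nat.add_sub_add_right] using h (k + 1) (by omega) (by omega)
  · rintro ⟨⟨hi, hj, h⟩, hij⟩
    refine ⟨by omega, by omega, fun k hk hkN => ?_⟩
    obtain ⟨k, rfl⟩ := Nat.exists_eq_add_of_le' hk
    rcases k.eq_zero_or_pos with rfl | hk0
    · exact hij
    · simpa only [Nat.add_sub_add_right] using h k hk0 (by omega)

theorem agreeLeft_add :
    AgreeLeft w (N + d) (i + d) (j + d) ↔ AgreeLeft w N i j ∧ Agree w d i j := by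
  induction d with
  | zero => simp [Agree]
  | succ d ih =>
    rw [← add_assoc, ← add_assoc, ← add_assoc, agreeLeft_succ, ih, agree_succ, and_assoc]

theorem agreeLeft_add_self : AgreeLeft w N (i + N) (j + N) ↔ Agree w N i j := by
  have hzero : AgreeLeft w 0 i j := ⟨i.zero_le, j.zero_le, by omega⟩
  simpa only [zero_add, hzero, true_and] using
    agreeLeft_add (w := w) (N := 0) (d := N) (i := i) (j := j)

/-- No period `d ≥ 1` persists in `w` over arbitrarily long stretches. -/
def UniformlyAperiodic (w : ℕ → α) : Prop := ∀ d, 1 ≤ d → ∃ L, ∀ n, ¬ Agree w L (n + d) n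

theorem UniformlyAperiodic.exists_agree_ne (hw : UniformlyAperiodic w) (hfin : (Set.range w).Finite)
    (N m : ℕ) : ∃ i j, m ≤ i ∧ m ≤ j ∧ Agree w N i j ∧ w (i + N) ≠ w (j + N) := by
  by_contra! hdet
  have := hfin.to_subtype
  obtain ⟨i, j, hij, hfactor⟩ := Finite.exists_ne_map_eq_of_infinite
    fun (i : ℕ) (k : Fin N) => (⟨w (m + i + k), Set.mem_range_self _⟩ : Set.range w)
  wlog hlt : i < j generalizing i j
  · exact this j i hij.symm hfactor.symm (by omega)
  have hagree : ∀ k, Agree w N (m + i + k) (m + j + k) := by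
    intro k
    induction k with
    | zero => exact fun l hl => congrArg Subtype.val (congrFun hfactor ⟨l, hl⟩)
    | succ k ih => exact (agree_succ.mpr ⟨ih, hdet _ _ (by omega) (by omega) ih⟩).tail
  obtain ⟨L, hL⟩ := hw (j - i) (by omega)
  refine hL (m + i + N) fun k _ => ?_
  have := hdet _ _ (by omega) (by omega) (hagree k)
  rw [show m + i + N + (j - i) + k = m + j + k + N by omega, ← this]
  congr 1; omega

/-- The block of length `N` that ends just before the position `i` is right special, that is, it
occurs elsewhere in `w` followed by a letter other than `w i`. -/
def RightSpecialAt (w : ℕ → α) (N i : ℕ) : Prop := ∃ j, AgreeLeft w N i j ∧ w i ≠ w j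

theorem RightSpecialAt.mono (h : RightSpecialAt w M i) (hNM : N ≤ M) : RightSpecialAt w N i :=
  h.imp fun _ hj => ⟨hj.1.mono hNM, hj.2⟩

theorem AgreeLeft.rightSpecialAt (h : AgreeLeft w N i j) (hj : RightSpecialAt w N j) :
    RightSpecialAt w N i := by
  obtain ⟨k, hjk, hne⟩ := hj
  by_cases hij : w i = w j
  · exact ⟨k, h.trans hjk, hij ▸ hne⟩
  · exact ⟨j, h, hij⟩

theorem UniformlyAperiodic.exists_rightSpecialAt_ge (hw : UniformlyAperiodic w)
    (hfin : (Set.range w).Finite) (N m : ℕ) : ∃ i, m ≤ i ∧ RightSpecialAt w N i := by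
  obtain ⟨i, j, hi, -, hij, hne⟩ := hw.exists_agree_ne hfin N m
  exact ⟨i + N, by omega, j + N, agreeLeft_add_self.mpr hij, hne⟩

/-- From length `n₀` on, `w` has exactly one right special block of each length, and it is followed
by the letters `a` and `b` only. -/
structure SpecialWord (w : ℕ → α) (n₀ : ℕ) (a b : α) : Prop where
  ne : a ≠ b
  agreeLeft : ∀ N, n₀ ≤ N → ∀ i j, RightSpecialAt w N i → RightSpecialAt w N j → AgreeLeft w N i j
  letters : ∀ N, n₀ ≤ N → w '' {i | RightSpecialAt w N i} = {a, b}

theorem SpecialWord.symm {n₀ : ℕ} {a b : α} (h : SpecialWord w n₀ a b) : SpecialWord w n₀ b a :=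
  ⟨h.ne.symm, h.agreeLeft, fun N hN => by rw [h.letters N hN, Set.pair_comm]⟩

theorem SpecialWord.exists_rightSpecialAt {n₀ : ℕ} {a b : α} (h : SpecialWord w n₀ a b)
    (hN : n₀ ≤ N) : ∃ i, RightSpecialAt w N i ∧ w i = a := by
  have ha : a ∈ w '' {i | RightSpecialAt w N i} := by rw [h.letters N hN]; exact Set.mem_insert a _
  exact ha

theorem SpecialWord.eq_or_eq {n₀ : ℕ} {a b : α} (h : SpecialWord w n₀ a b) (hN : n₀ ≤ N)
    (hi : RightSpecialAt w N i) : w i = a ∨ w i = b := by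
  have hmem : w i ∈ w '' {i | RightSpecialAt w N i} := Set.mem_image_of_mem w hi
  rwa [h.letters N hN] at hmem

end Words

section Complexity

variable {w : ℕ → ℕ} {n : ℕ}

theorem factors_finite (hfin : (Set.range w).Finite) (n : ℕ) : (factors w n).Finite := by
  refine (Set.Finite.pi' fun _ : Fin n => hfin).subset ?_
  rintro _ ⟨i, rfl⟩ k
  exact Set.mem_range_self _

theorem image_init_factors (w : ℕ → ℕ) (n : ℕ) :
    (Fin.init : (Fin (n + 1) → ℕ) → Fin n → ℕ) '' factors w (n + 1) = factors w n := by
  simp only [factors, ← Set.range_comp]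
  rfl

theorem UniformlyAperiodic.complexity_lt_succ (hw : UniformlyAperiodic w)
    (hfin : (Set.range w).Finite) (n : ℕ) : complexity w n < complexity w (n + 1) := by
  have hle := Set.ncard_image_le (f := Fin.init) (factors_finite hfin (n + 1))
  rw [image_init_factors] at hle
  refine hle.lt_of_ne fun heq => ?_
  have hinj : Set.InjOn (Fin.init : (Fin (n + 1) → ℕ) → Fin n → ℕ) (factors w (n + 1)) :=
    Set.injOn_of_ncard_image_eq (by rw [image_init_factors]; exact heq)
      (factors_finite hfin (n + 1))
  obtain ⟨i, j, -, -, hij, hne⟩ := hw.exists_agree_ne hfin n 0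
  exact hne (congrFun (hinj ⟨i, rfl⟩ ⟨j, rfl⟩ (agree_iff_factor_eq.mp hij)) (Fin.last n))

theorem exists_unique_collision {α β : Type*} {f : α → β} {S : Set α} (hS : S.Finite)
    (hcard : S.ncard = (f '' S).ncard + 1) :
    ∃ x ∈ S, ∃ y ∈ S, x ≠ y ∧ f x = f y ∧
      ∀ x' ∈ S, ∀ y' ∈ S, f x' = f y' → x' ≠ y' → x' = x ∨ x' = y := by
  obtain ⟨x, hx, y, hy, hxy, hne⟩ : ∃ x ∈ S, ∃ y ∈ S, f x = f y ∧ x ≠ y := by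
    by_contra! hcon
    have hinj : Set.InjOn f S := fun x hx y hy => hcon x hx y hy
    rw [hinj.ncard_image] at hcard
    omega
  have himg : f '' (S \ {x}) = f '' S := by
    refine (Set.image_mono Set.sdiff_subset).antisymm ?_
    rintro _ ⟨u, hu, rfl⟩
    by_cases hux : u = x
    · exact ⟨y, ⟨hy, hne.symm⟩, by rw [hux, hxy]⟩
    · exact ⟨u, ⟨hu, hux⟩, rfl⟩
  have hinj : Set.InjOn f (S \ {x}) := by
    refine Set.injOn_of_ncard_image_eq ?_ (hS.subset Set.sdiff_subset)
    rw [himg, Set.ncard_sdiff_singleton_of_mem hx, hcard, Nat.add_sub_cancel]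
  refine ⟨x, hx, y, hy, hne, hxy, fun x' hx' y' hy' hf hne' => or_iff_not_imp_left.mpr fun h => ?_⟩
  by_cases hy'x : y' = x
  · exact hinj ⟨hx', h⟩ ⟨hy, hne.symm⟩ (hf.trans ((congrArg f hy'x).trans hxy))
  · exact absurd (hinj ⟨hx', h⟩ ⟨hy', hy'x⟩ hf) hne'

theorem exists_rightSpecial_pair (hfin : (Set.range w).Finite)
    (hn : complexity w (n + 1) = complexity w n + 1) :
    ∃ i j, AgreeLeft w n i j ∧ w i ≠ w j ∧
      ∀ i', RightSpecialAt w n i' → AgreeLeft w n i' i ∧ (w i' = w i ∨ w i' = w j) := by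
  obtain ⟨_, ⟨i, rfl⟩, _, ⟨j, rfl⟩, hne, heq, huniq⟩ := exists_unique_collision
    (f := Fin.init) (factors_finite hfin (n + 1)) (by rw [image_init_factors]; exact hn)
  simp only [ne_eq, ← agree_iff_factor_eq] at hne
  have hij : Agree w n i j := agree_iff_factor_eq.mpr heq
  refine ⟨i + n, j + n, agreeLeft_add_self.mpr hij, fun h => hne (agree_succ.mpr ⟨hij, h⟩), ?_⟩
  rintro i' ⟨j', hij', hne'⟩
  obtain ⟨i', rfl⟩ := Nat.exists_eq_add_of_le' hij'.1
  obtain ⟨j', rfl⟩ := Nat.exists_eq_add_of_le' hij'.2.1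
  rcases huniq _ ⟨i', rfl⟩ _ ⟨j', rfl⟩ (agree_iff_factor_eq.mp (agreeLeft_add_self.mp hij'))
    fun h => hne' (congrFun h (Fin.last n)) with h | h
  all_goals obtain ⟨h, hlast⟩ := agree_succ.mp (agree_iff_factor_eq.mpr h)
  · exact ⟨agreeLeft_add_self.mpr h, Or.inl hlast⟩
  · exact ⟨(agreeLeft_add_self.mpr h).trans (agreeLeft_add_self.mpr hij).symm, Or.inr hlast⟩

theorem exists_specialWord_of_complexity_succ (hfin : (Set.range w).Finite) {n₀ : ℕ}
    (hn : ∀ n, n₀ ≤ n → complexity w (n + 1) = complexity w n + 1) :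
    ∃ a b, SpecialWord w n₀ a b := by
  choose! i j hij hne hspecial using fun n hn' => exists_rightSpecial_pair hfin (hn n hn')
  have hletters : ∀ n, n₀ ≤ n → w '' {k | RightSpecialAt w n k} = {w (i n), w (j n)} := by
    refine fun n hn' => Set.Subset.antisymm ?_ (Set.pair_subset ?_ ?_)
    · rintro _ ⟨k, hk, rfl⟩
      exact (hspecial n hn' k hk).2
    · exact ⟨i n, ⟨j n, hij n hn', hne n hn'⟩, rfl⟩
    · exact ⟨j n, ⟨i n, (hij n hn').symm, (hne n hn').symm⟩, rfl⟩
  refine ⟨w (i n₀), w (j n₀), hne n₀ le_rfl, fun n hn' k l hk hl =>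
    (hspecial n hn' k hk).1.trans (hspecial n hn' l hl).1.symm, fun n hn' => ?_⟩
  rw [← hletters n₀ le_rfl]
  refine Set.eq_of_subset_of_ncard_le (Set.image_mono fun k hk => hk.mono hn') ?_
    (hfin.subset (Set.image_subset_range _ _))
  rw [hletters n₀ le_rfl, hletters n hn', Set.ncard_pair (hne n₀ le_rfl),
    Set.ncard_pair (hne n hn')]

theorem UniformlyAperiodic.exists_specialWord (hw : UniformlyAperiodic w)
    (hfin : (Set.range w).Finite)
    (hlim : ¬ Tendsto (fun n : ℕ => (complexity w n : ℤ) - (n : ℤ)) atTop atTop) :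
    ∃ n₀ a b, SpecialWord w n₀ a b := by
  have hmono : Monotone fun n : ℕ => (complexity w n : ℤ) - (n : ℤ) :=
    monotone_nat_of_le_succ fun n => by
      have := hw.complexity_lt_succ hfin n
      push_cast; omega
  obtain ⟨l, hl⟩ := (tendsto_atTop_of_monotone hmono).resolve_left hlim
  rw [nhds_discrete, tendsto_pure, eventually_atTop] at hl
  obtain ⟨n₀, hn₀⟩ := hl
  refine ⟨n₀, exists_specialWord_of_complexity_succ hfin fun n hn => ?_⟩
  have h := hn₀ n hn
  have h' := hn₀ (n + 1) (by omega)
  push_cast at h'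
  omega

end Complexity

section ReturnWords

variable {α : Type*} {w : ℕ → α} {N M d i j k n₀ : ℕ} {a b c : α} {u v u' : List α}

/-- The block of length `d` of the word `w` starting at the position `i`. -/
def block (w : ℕ → α) (i d : ℕ) : List α := (List.range d).map fun k => w (i + k)

theorem length_block : (block w i d).length = d := by simp [block]

theorem block_add (w : ℕ → α) (i d e : ℕ) :
    block w i (d + e) = block w i d ++ block w (i + d) e := by
  simp [block, List.range_add, add_assoc, Function.comp_def]

theorem block_eq_block_iff : block w i d = block w j d ↔ Agree w d i j := by
  simp [block, Agree]

theorem block_add_mul_of_agree (h : Agree w (d * k) (i + d) i) :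
    block w (i + d * k) d = block w i d := by
  induction k with
  | zero => rfl
  | succ k ih =>
    rw [← ih fun j hj => h j (hj.trans_le (Nat.mul_le_mul_left d k.le_succ)), block_eq_block_iff]
    intro j hj
    have := h (d * k + j) (by rw [Nat.mul_succ]; omega)
    rwa [show i + d + (d * k + j) = i + d * (k + 1) + j by ring, ← add_assoc] at this

/-- `u` is the block of `w` read from any right special occurrence of length `N` that is followed by
the letter `c` up to the next right special occurrence of length `N`. -/
structure IsReturnWord (w : ℕ → α) (N : ℕ) (c : α) (u : List α) : Prop where
  ne_nil : u ≠ []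
  block_eq : ∀ i, RightSpecialAt w N i → w i = c → block w i u.length = u
  add : ∀ i, RightSpecialAt w N i → w i = c → RightSpecialAt w N (i + u.length)
  not_add : ∀ i, RightSpecialAt w N i → w i = c →
    ∀ k, 0 < k → k < u.length → ¬ RightSpecialAt w N (i + k)

/-- Far enough in `w`, every right special block of length `N + 1` is reached along the return word
`u` of the right special block of length `N`. -/
def Absorbs (w : ℕ → α) (N : ℕ) (c : α) (u : List α) : Prop :=
  ∀ᶠ j in atTop, RightSpecialAt w (N + 1) j →
    ∃ i, RightSpecialAt w N i ∧ w i = c ∧ j = i + u.length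

namespace IsReturnWord

theorem length_pos (h : IsReturnWord w N c u) : 0 < u.length := List.length_pos_iff.mpr h.ne_nil

theorem eq_add_length (h : IsReturnWord w N c u) (hi : RightSpecialAt w N i) (hc : w i = c)
    (hij : i < j) (hj : RightSpecialAt w N j) (hnot : ∀ k, i < k → k < j → ¬ RightSpecialAt w N k) :
    j = i + u.length := by
  have hpos := h.length_pos
  rcases lt_trichotomy j (i + u.length) with hlt | heq | hgt
  · refine absurd ?_ (h.not_add i hi hc (j - i) (by omega) (by omega))
    rwa [Nat.add_sub_cancel' hij.le]
  · exact heq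
  · exact absurd (h.add i hi hc) (hnot _ (by omega) hgt)

theorem unique (h : IsReturnWord w N c u) (h' : IsReturnWord w N c u') (hi : RightSpecialAt w N i)
    (hc : w i = c) : u = u' := by
  have hlen : i + u.length = i + u'.length :=
    h'.eq_add_length hi hc (Nat.lt_add_of_pos_right h.length_pos) (h.add i hi hc) fun k hk hk' => by
      simpa only [Nat.add_sub_cancel' hk.le] using h.not_add i hi hc (k - i) (by omega) (by omega)
  rw [← h.block_eq i hi hc, ← h'.block_eq i hi hc, Nat.add_left_cancel hlen]

theorem agree (h : IsReturnWord w N c u) (hi : RightSpecialAt w N i) (hic : w i = c)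
    (hj : RightSpecialAt w N j) (hjc : w j = c) : Agree w u.length i j :=
  block_eq_block_iff.mp ((h.block_eq i hi hic).trans (h.block_eq j hj hjc).symm)

theorem exists_next_ne (h : IsReturnWord w N c u) (hw : UniformlyAperiodic w)
    (hi : RightSpecialAt w N i) (hc : w i = c) :
    ∃ j, RightSpecialAt w N j ∧ w j = c ∧ w (j + u.length) ≠ c := by
  by_contra! hnext
  obtain ⟨L, hL⟩ := hw u.length h.length_pos
  have hiter : ∀ k, RightSpecialAt w N (i + u.length * k) ∧ w (i + u.length * k) = c := by
    intro k
    induction k with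
    | zero => exact ⟨hi, hc⟩
    | succ k ih =>
      rw [mul_add, mul_one, ← add_assoc]
      exact ⟨h.add _ ih.1 ih.2, hnext _ ih.1 ih.2⟩
  refine hL i fun k _ => ?_
  have hagree := h.agree (hiter (k / u.length + 1)).1 (hiter _).2 (hiter (k / u.length)).1
    (hiter _).2 (k % u.length) (Nat.mod_lt _ h.length_pos)
  have hdiv := Nat.div_add_mod k u.length
  rw [show i + u.length + k = i + u.length * (k / u.length + 1) + k % u.length by
    rw [mul_add]; omega, hagree]
  congr 1; omega

theorem succ_of_add (h : IsReturnWord w N c u)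
    (hadd : ∀ i, RightSpecialAt w N i → w i = c → RightSpecialAt w (N + 1) (i + u.length)) :
    IsReturnWord w (N + 1) c u where
  ne_nil := h.ne_nil
  block_eq i hi := h.block_eq i (hi.mono N.le_succ)
  add i hi := hadd i (hi.mono N.le_succ)
  not_add i hi hc k hk hk' hik :=
    h.not_add i (hi.mono N.le_succ) hc k hk hk' (hik.mono N.le_succ)

theorem append (hu : IsReturnWord w N a u) (hv : IsReturnWord w N b v)
    (hnext : ∀ i, RightSpecialAt w N i → w i = b → w (i + v.length) = a)
    (hu' : ∀ i, RightSpecialAt w N i → w i = a → RightSpecialAt w (N + 1) (i + u.length))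
    (hv' : ∀ i, RightSpecialAt w N i → w i = b → ¬ RightSpecialAt w (N + 1) (i + v.length)) :
    IsReturnWord w (N + 1) b (v ++ u) where
  ne_nil := List.append_ne_nil_of_left_ne_nil hv.ne_nil u
  block_eq i hi hb := by
    have hi := hi.mono N.le_succ
    rw [List.length_append, block_add, hv.block_eq i hi hb,
      hu.block_eq _ (hv.add i hi hb) (hnext i hi hb)]
  add i hi hb := by
    have hi := hi.mono N.le_succ
    rw [List.length_append, ← add_assoc]
    exact hu' _ (hv.add i hi hb) (hnext i hi hb)
  not_add i hi hb k hk hk' hik := by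
    have hi := hi.mono N.le_succ
    rw [List.length_append] at hk'
    rcases lt_trichotomy k v.length with hlt | rfl | hgt
    · exact hv.not_add i hi hb k hk hlt (hik.mono N.le_succ)
    · exact hv' i hi hb hik
    · refine hu.not_add _ (hv.add i hi hb) (hnext i hi hb) (k - v.length) (by omega) (by omega) ?_
      rw [add_assoc, Nat.add_sub_cancel' hgt.le]
      exact hik.mono N.le_succ

end IsReturnWord

namespace SpecialWord

theorem agreeLeft_add_length (h : SpecialWord w n₀ a b) (hN : n₀ ≤ N) (hu : IsReturnWord w N c u)
    (hi : RightSpecialAt w N i) (hic : w i = c) (hj : RightSpecialAt w N j) (hjc : w j = c) :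
    AgreeLeft w (N + 1) (i + u.length) (j + u.length) :=
  (agreeLeft_add.mpr ⟨h.agreeLeft N hN i j hi hj, hu.agree hi hic hj hjc⟩).mono
    (Nat.add_le_add_left hu.length_pos N)

theorem exists_isReturnWord (h : SpecialWord w n₀ a b) (hw : UniformlyAperiodic w)
    (hfin : (Set.range w).Finite) (hN : n₀ ≤ N) : ∃ u, IsReturnWord w N a u := by
  classical
  obtain ⟨i₀, hi₀, ha₀⟩ := h.exists_rightSpecialAt hN
  have hex : ∃ d, 0 < d ∧ RightSpecialAt w N (i₀ + d) := by
    obtain ⟨i, hi, hspecial⟩ := hw.exists_rightSpecialAt_ge hfin N (i₀ + 1)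
    exact ⟨i - i₀, by omega, by rwa [Nat.add_sub_cancel' (by omega)]⟩
  set d := Nat.find hex
  obtain ⟨hd, hadd⟩ := Nat.find_spec hex
  have hnot : ∀ k, 0 < k → k < d → ¬ RightSpecialAt w N (i₀ + k) := fun k hk hkd hik =>
    Nat.find_min hex hkd ⟨hk, hik⟩
  have hagree : ∀ i, RightSpecialAt w N i → w i = a → ∀ k ≤ d,
      AgreeLeft w (N + k) (i₀ + k) (i + k) := by
    intro i hi ha k
    induction k with
    | zero => exact fun _ => h.agreeLeft N hN i₀ i hi₀ hi
    | succ k ih =>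
      intro hk
      have hik := ih (by omega)
      refine agreeLeft_succ.mpr ⟨hik, ?_⟩
      rcases k.eq_zero_or_pos with rfl | hk0
      · exact ha₀.trans ha.symm
      · by_contra hne
        exact hnot k hk0 (by omega) ⟨i + k, hik.mono (Nat.le_add_right N k), hne⟩
  refine ⟨block w i₀ d, ?_, fun i hi ha => ?_, fun i hi ha => ?_, fun i hi ha k hk hkd => ?_⟩
  · exact List.ne_nil_of_length_pos (by rwa [length_block])
  · rw [length_block]
    exact (block_eq_block_iff.mpr (agreeLeft_add.mp (hagree i hi ha d le_rfl)).2).symm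
  · rw [length_block]
    exact ((hagree i hi ha d le_rfl).mono (Nat.le_add_right N d)).symm.rightSpecialAt hadd
  · rw [length_block] at hkd
    exact fun hik => hnot k hk hkd
      (((hagree i hi ha k hkd.le).mono (Nat.le_add_right N k)).rightSpecialAt hik)

theorem eventually_exists_return (h : SpecialWord w n₀ a b) (hN : n₀ ≤ N)
    (hu : IsReturnWord w N a u) (hv : IsReturnWord w N b v) :
    ∀ᶠ j in atTop, RightSpecialAt w N j → ∃ i, RightSpecialAt w N i ∧
      ((w i = a ∧ j = i + u.length) ∨ (w i = b ∧ j = i + v.length)) := by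
  classical
  obtain ⟨i₀, hi₀, -⟩ := h.exists_rightSpecialAt hN
  filter_upwards [eventually_gt_atTop i₀] with j hij₀ hj
  set i := Nat.findGreatest (RightSpecialAt w N) (j - 1)
  have hi : RightSpecialAt w N i := Nat.findGreatest_spec (by omega : i₀ ≤ j - 1) hi₀
  have hij : i < j := by have : i ≤ j - 1 := Nat.findGreatest_le _; omega
  have hnot : ∀ k, i < k → k < j → ¬ RightSpecialAt w N k := fun k hk hkj =>
    Nat.findGreatest_is_greatest hk (by omega)
  exact ⟨i, hi, (h.eq_or_eq hN hi).imp (fun hc => ⟨hc, hu.eq_add_length hi hc hij hj hnot⟩)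
    fun hc => ⟨hc, hv.eq_add_length hi hc hij hj hnot⟩⟩

theorem append_of_not_add (h : SpecialWord w n₀ a b) (hw : UniformlyAperiodic w) (hN : n₀ ≤ N)
    (hu : IsReturnWord w N a u) (hv : IsReturnWord w N b v)
    (hu' : ∀ i, RightSpecialAt w N i → w i = a → RightSpecialAt w (N + 1) (i + u.length))
    (hv' : ∀ i, RightSpecialAt w N i → w i = b → ¬ RightSpecialAt w (N + 1) (i + v.length)) :
    IsReturnWord w (N + 1) b (v ++ u) ∧ Absorbs w N a u := by
  refine ⟨hu.append hv (fun i hi hb => ?_) hu' hv', ?_⟩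
  · obtain ⟨j, hj, hjb, hne⟩ := hv.exists_next_ne hw hi hb
    have hja : w (j + v.length) = a := (h.eq_or_eq hN (hv.add j hj hjb)).resolve_right hne
    by_contra hia
    exact hv' i hi hb ⟨j + v.length, h.agreeLeft_add_length hN hv hi hb hj hjb, hja ▸ hia⟩
  · filter_upwards [h.eventually_exists_return hN hu hv] with j hprev hj
    obtain ⟨i, hi, hia | ⟨hib, rfl⟩⟩ := hprev (hj.mono N.le_succ)
    · exact ⟨i, hi, hia⟩
    · exact absurd hj (hv' i hi hib)

theorem isReturnWord_succ (h : SpecialWord w n₀ a b) (hw : UniformlyAperiodic w)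
    (hfin : (Set.range w).Finite) (hN : n₀ ≤ N) (hu : IsReturnWord w N a u)
    (hv : IsReturnWord w N b v) :
    (IsReturnWord w (N + 1) a u ∧ IsReturnWord w (N + 1) b v) ∨
    (IsReturnWord w (N + 1) a u ∧ IsReturnWord w (N + 1) b (v ++ u) ∧ Absorbs w N a u) ∨
    (IsReturnWord w (N + 1) a (u ++ v) ∧ IsReturnWord w (N + 1) b v ∧ Absorbs w N b v) := by
  have hdich : ∀ {c u}, IsReturnWord w N c u →
      (∀ i, RightSpecialAt w N i → w i = c → RightSpecialAt w (N + 1) (i + u.length)) ∨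
      (∀ i, RightSpecialAt w N i → w i = c → ¬ RightSpecialAt w (N + 1) (i + u.length)) := by
    intro c u hu
    by_contra! hcon
    obtain ⟨⟨i, hi, hic, hnot⟩, j, hj, hjc, hadd⟩ := hcon
    exact hnot ((h.agreeLeft_add_length hN hu hi hic hj hjc).rightSpecialAt hadd)
  rcases hdich hu with hu' | hu' <;> rcases hdich hv with hv' | hv'
  · exact Or.inl ⟨hu.succ_of_add hu', hv.succ_of_add hv'⟩
  · exact Or.inr (Or.inl ⟨hu.succ_of_add hu', h.append_of_not_add hw hN hu hv hu' hv'⟩)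
  · obtain ⟨hau, habs⟩ := h.symm.append_of_not_add hw hN hv hu hv' hu'
    exact Or.inr (Or.inr ⟨hau, hv.succ_of_add hv', habs⟩)
  · obtain ⟨m, hm⟩ := eventually_atTop.mp (h.eventually_exists_return hN hu hv)
    obtain ⟨j, hmj, hj⟩ := hw.exists_rightSpecialAt_ge hfin (N + 1) m
    obtain ⟨i, hi, ⟨hc, rfl⟩ | ⟨hc, rfl⟩⟩ := hm j hmj (hj.mono N.le_succ)
    · exact absurd hj (hu' i hi hc)
    · exact absurd hj (hv' i hi hc)

theorem exists_not_isReturnWord (h : SpecialWord w n₀ a b) (hw : UniformlyAperiodic w)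
    (u : List α) (M : ℕ) : ∃ N, M ≤ N ∧ ¬ IsReturnWord w N a u := by
  by_contra! hu
  obtain ⟨L, hL⟩ := hw u.length (hu M le_rfl).length_pos
  have hN := hu (max L (max M n₀)) (by omega)
  obtain ⟨i, hi, ha⟩ := h.exists_rightSpecialAt (show n₀ ≤ max L (max M n₀) by omega)
  have hagree := (h.agreeLeft _ (by omega) _ i (hN.add i hi ha) hi).mono (le_max_left L _)
  obtain ⟨i, rfl⟩ := Nat.exists_eq_add_of_le' hagree.2.1
  rw [add_right_comm, agreeLeft_add_self] at hagree
  exact hL i hagree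

theorem exists_absorbs (h : SpecialWord w n₀ a b) (hw : UniformlyAperiodic w)
    (hfin : (Set.range w).Finite) (hN : n₀ ≤ N) (hv : IsReturnWord w N b v) :
    ∃ M, N ≤ M ∧ IsReturnWord w M b v ∧ ∃ u, IsReturnWord w M a u ∧ Absorbs w M a u := by
  by_contra! hcon
  obtain ⟨M, hM, hnot⟩ := h.symm.exists_not_isReturnWord hw v N
  refine hnot (Nat.le_induction hv (fun K hK hvK => ?_) M hM)
  obtain ⟨u, hu⟩ := h.exists_isReturnWord hw hfin (hN.trans hK)
  rcases h.isReturnWord_succ hw hfin (hN.trans hK) hu hvK with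
    ⟨-, hv'⟩ | ⟨-, -, habs⟩ | ⟨-, hv', -⟩
  · exact hv'
  · exact absurd habs (hcon K hK hvK u hu)
  · exact hv'

end SpecialWord

end ReturnWords

section FiniteGroup

open scoped Pointwise

variable {α G : Type*} [Group G] {w : ℕ → α} {N M n₀ : ℕ} {a b c : α} {u v u' v' : List α}

/-- The elements of `G` that are the product of `φ` over the prefix of `w` before infinitely many
right special occurrences of length `N`. -/
def recurrentProducts (w : ℕ → α) (φ : α → G) (N : ℕ) : Set G :=
  {g | ∃ᶠ i in atTop, RightSpecialAt w N i ∧ ((block w 0 i).map φ).prod = g}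

theorem recurrentProducts_antitone (w : ℕ → α) (φ : α → G) : Antitone (recurrentProducts w φ) :=
  fun _ _ hNM _ hg => Frequently.mono hg fun _ hi => ⟨hi.1.mono hNM, hi.2⟩

theorem recurrentProducts_nonempty [Finite G] (φ : α → G) (hw : UniformlyAperiodic w)
    (hfin : (Set.range w).Finite) (N : ℕ) : (recurrentProducts w φ N).Nonempty := by
  refine frequently_exists.mp (frequently_atTop.mpr fun m => ?_)
  obtain ⟨i, hi, hspecial⟩ := hw.exists_rightSpecialAt_ge hfin N m
  exact ⟨i, hi, _, hspecial, rfl⟩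

theorem Absorbs.recurrentProducts_succ_subset (habs : Absorbs w N c u)
    (hu : IsReturnWord w N c u) (φ : α → G) :
    recurrentProducts w φ (N + 1) ⊆ MulOpposite.op (u.map φ).prod • recurrentProducts w φ N := by
  intro g hg
  rw [Set.mem_smul_set_iff_inv_smul_mem, ← MulOpposite.op_inv, op_smul_eq_mul]
  refine frequently_atTop.mpr fun m => ?_
  obtain ⟨j, hmj, ⟨hj, hjg⟩, hprev⟩ := frequently_atTop.mp (hg.and_eventually habs) (m + u.length)
  obtain ⟨i, hi, hc, rfl⟩ := hprev hj
  refine ⟨i, Nat.le_of_add_le_add_right hmj, hi, eq_mul_inv_of_mul_eq ?_⟩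
  rw [← hjg, block_add, zero_add, hu.block_eq i hi hc, List.map_append, List.prod_append]

theorem Absorbs.op_prod_smul_recurrentProducts [Finite G] (habs : Absorbs w N c u)
    (hu : IsReturnWord w N c u) (φ : α → G)
    (hstab : recurrentProducts w φ (N + 1) = recurrentProducts w φ N) :
    MulOpposite.op (u.map φ).prod • recurrentProducts w φ N = recurrentProducts w φ N := by
  refine (Set.eq_of_subset_of_ncard_le (hstab ▸ habs.recurrentProducts_succ_subset hu φ) ?_).symm
  rw [Set.ncard_smul_set]

namespace SpecialWord

theorem closure_pair_le_of_le (h : SpecialWord w n₀ a b) (hw : UniformlyAperiodic w)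
    (hfin : (Set.range w).Finite) (φ : α → G) (hN : n₀ ≤ N) (hNM : N ≤ M)
    (hu : IsReturnWord w N a u) (hv : IsReturnWord w N b v) (hu' : IsReturnWord w M a u')
    (hv' : IsReturnWord w M b v') :
    Subgroup.closure {(u.map φ).prod, (v.map φ).prod} ≤
      Subgroup.closure {(u'.map φ).prod, (v'.map φ).prod} := by
  have hunique : ∀ {K c y y'}, IsReturnWord w K c y → IsReturnWord w K c y' →
      (∃ i, RightSpecialAt w K i ∧ w i = c) → y = y' := fun hy hy' ⟨_, hi, hc⟩ =>
    hy.unique hy' hi hc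
  induction M, hNM using Nat.le_induction generalizing u' v' with
  | base =>
    rw [hunique hu hu' (h.exists_rightSpecialAt hN),
      hunique hv hv' (h.symm.exists_rightSpecialAt hN)]
  | succ K hNK ih =>
    have hK := hN.trans hNK
    have hexa := h.exists_rightSpecialAt (hK.trans K.le_succ)
    have hexb := h.symm.exists_rightSpecialAt (hK.trans K.le_succ)
    obtain ⟨y, hy⟩ := h.exists_isReturnWord hw hfin hK
    obtain ⟨z, hz⟩ := h.symm.exists_isReturnWord hw hfin hK
    refine (ih hy hz).trans ((Subgroup.closure_le _).mpr ?_)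
    have hmem_left := Subgroup.subset_closure
      (Set.mem_insert (u'.map φ).prod {(v'.map φ).prod})
    have hmem_right := Subgroup.subset_closure
      (Set.mem_insert_of_mem (u'.map φ).prod (Set.mem_singleton (v'.map φ).prod))
    rcases h.isReturnWord_succ hw hfin hK hy hz with ⟨hy', hz'⟩ | ⟨hy', hz', -⟩ | ⟨hy', hz', -⟩
    all_goals
      obtain rfl := hunique hu' hy' hexa
      obtain rfl := hunique hv' hz' hexb
      simp only [List.map_append, List.prod_append, SetLike.mem_coe] at hmem_left hmem_right ⊢
    · exact Set.pair_subset hmem_left hmem_right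
    · exact Set.pair_subset hmem_left ((Subgroup.mul_mem_cancel_right _ hmem_left).mp hmem_right)
    · exact Set.pair_subset ((Subgroup.mul_mem_cancel_right _ hmem_right).mp hmem_left) hmem_right

theorem exists_prod_mem (h : SpecialWord w n₀ a b) (hw : UniformlyAperiodic w)
    (hfin : (Set.range w).Finite) (φ : α → G) {T : Subgroup G} {N₀ : ℕ}
    (hT : ∀ N, N₀ ≤ N → ∀ c u, IsReturnWord w N c u → Absorbs w N c u → (u.map φ).prod ∈ T) :
    ∃ M, N₀ ≤ M ∧ ∃ u v, IsReturnWord w M a u ∧ IsReturnWord w M b v ∧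
      (u.map φ).prod ∈ T ∧ (v.map φ).prod ∈ T := by
  obtain ⟨v₀, hv₀⟩ := h.symm.exists_isReturnWord hw hfin (le_max_left n₀ N₀)
  obtain ⟨M₁, hM₁, -, u, hu₁, hu_abs⟩ := h.exists_absorbs hw hfin (le_max_left n₀ N₀) hv₀
  obtain ⟨M, hM, hu, v, hv, hv_abs⟩ :=
    h.symm.exists_absorbs hw hfin ((le_max_left n₀ N₀).trans hM₁) hu₁
  have hN₀ := (le_max_right n₀ N₀).trans hM₁
  exact ⟨M, hN₀.trans hM, u, v, hu, hv, hT M₁ hN₀ a u hu₁ hu_abs, hT M (hN₀.trans hM) b v hv hv_abs⟩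

theorem exists_forall_mem_closure [Finite G] (h : SpecialWord w n₀ a b) (hw : UniformlyAperiodic w)
    (hfin : (Set.range w).Finite) (φ : α → G) (hN : n₀ ≤ N)
    (hu : IsReturnWord w N a u) (hv : IsReturnWord w N b v) :
    ∃ x : G, ∀ g ∈ Subgroup.closure {(u.map φ).prod, (v.map φ).prod},
      ∃ i, ((block w 0 i).map φ).prod = x * g := by
  obtain ⟨_, ⟨N₀, rfl⟩, hmin⟩ :=
    wellFounded_lt.has_min (Set.range (recurrentProducts w φ)) (Set.range_nonempty _)
  have hstab : ∀ K, N₀ ≤ K → recurrentProducts w φ K = recurrentProducts w φ N₀ := fun K hK =>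
    eq_of_le_of_not_lt (recurrentProducts_antitone w φ hK) (hmin _ ⟨K, rfl⟩)
  set V := recurrentProducts w φ N₀
  set T : Subgroup G := (MulAction.stabilizer Gᵐᵒᵖ V).unop
  have hT : ∀ K, N₀ ≤ K → ∀ c y, IsReturnWord w K c y → Absorbs w K c y → (y.map φ).prod ∈ T := by
    intro K hK c y hy habs
    have := habs.op_prod_smul_recurrentProducts hy φ
      ((hstab (K + 1) (by omega)).trans (hstab K hK).symm)
    rwa [hstab K hK] at this
  obtain ⟨M, hM, u', v', hu', hv', huT, hvT⟩ := h.exists_prod_mem hw hfin φ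
    (N₀ := max N N₀) fun K hK => hT K ((le_max_right N N₀).trans hK)
  have hle : Subgroup.closure {(u.map φ).prod, (v.map φ).prod} ≤ T :=
    (h.closure_pair_le_of_le hw hfin φ hN ((le_max_left N N₀).trans hM) hu hv hu' hv').trans
      ((Subgroup.closure_le T).mpr (Set.pair_subset huT hvT))
  obtain ⟨x, hx⟩ := recurrentProducts_nonempty φ hw hfin N₀
  refine ⟨x, fun g hg => ?_⟩
  have hxg : MulOpposite.op g • x ∈ V := (hle hg : _ • V = V) ▸ Set.smul_mem_smul_set hx
  obtain ⟨i, -, hi⟩ := Frequently.exists hxg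
  exact ⟨i, hi⟩

end SpecialWord

end FiniteGroup

section Matrices

open Matrix CongruenceSubgroup

/-- The matrix of one step of the continued fraction algorithm with partial quotient `a`. Row
vectors are used throughout: multiplication by it on the right takes `(qₙ, qₙ₋₁)` to
`(a qₙ + qₙ₋₁, qₙ)`, so that products over words are taken in their natural order. -/
def cfStep (a : ℕ) : GL (Fin 2) ℤ where
  val := !![(a : ℤ), 1; 1, 0]
  inv := !![0, 1; 1, -(a : ℤ)]
  val_inv := by simp [Matrix.one_fin_two]
  inv_val := by simp [Matrix.one_fin_two]

/-- Integer matrices which, like the products of the matrices `cfStep a` with `1 ≤ a`, have entries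
that decrease down both columns. -/
structure Dominant (X : Matrix (Fin 2) (Fin 2) ℤ) : Prop where
  one_le_left : 1 ≤ X 1 0
  left_le : X 1 0 ≤ X 0 0
  zero_le_right : 0 ≤ X 1 1
  right_le : X 1 1 ≤ X 0 1
  one_le_right : 1 ≤ X 0 1

variable {X Y : Matrix (Fin 2) (Fin 2) ℤ} {a b : ℕ}

theorem dominant_cfStep (ha : 1 ≤ a) : Dominant (cfStep a : Matrix (Fin 2) (Fin 2) ℤ) := by
  constructor <;> simp [cfStep, ha]

theorem Dominant.mul (hX : Dominant X) (hY : Dominant Y) : Dominant (X * Y) := by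
  obtain ⟨x1, x2, x3, x4, _⟩ := hX
  obtain ⟨y1, y2, y3, y4, y5⟩ := hY
  constructor <;> simp only [Matrix.mul_apply, Fin.sum_univ_two] <;>
    nlinarith [mul_nonneg x3 y3]

/-- The submonoid of the dominant matrices, with the identity added. -/
def dominantSubmonoid : Submonoid (Matrix (Fin 2) (Fin 2) ℤ) where
  carrier := {X | X = 1 ∨ Dominant X}
  one_mem' := Or.inl rfl
  mul_mem' := by
    rintro X Y (rfl | hX) (rfl | hY)
    · exact Or.inl (one_mul 1)
    · exact Or.inr ((one_mul Y).symm ▸ hY)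
    · exact Or.inr ((mul_one X).symm ▸ hX)
    · exact Or.inr (hX.mul hY)

theorem Dominant.mem (hX : Dominant X) : X ∈ dominantSubmonoid := Or.inr hX

theorem Dominant.mul_of_mem (hX : Dominant X) (hY : Y ∈ dominantSubmonoid) : Dominant (X * Y) := by
  rcases hY with rfl | hY
  · rwa [mul_one]
  · exact hX.mul hY

theorem Dominant.mul_of_mem_left (hX : X ∈ dominantSubmonoid) (hY : Dominant Y) :
    Dominant (X * Y) := by
  rcases hX with rfl | hX
  · rwa [one_mul]
  · exact hX.mul hY

theorem Dominant.pow_succ (hX : Dominant X) (n : ℕ) : Dominant (X ^ (n + 1)) := by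
  rw [_root_.pow_succ']
  exact hX.mul_of_mem (pow_mem hX.mem n)

theorem prod_map_cfStep_mem_dominantSubmonoid {u : List ℕ} (hu : ∀ n ∈ u, 1 ≤ n) :
    ((u.map cfStep).prod : Matrix (Fin 2) (Fin 2) ℤ) ∈ dominantSubmonoid := by
  rw [← Units.coeHom_apply, map_list_prod, List.map_map]
  refine list_prod_mem fun X hX => ?_
  obtain ⟨n, hn, rfl⟩ := List.mem_map.mp hX
  exact (dominant_cfStep (hu n hn)).mem

/-- One reads off `a` from the first column of the product: the quotient of its entries lies in
`(a, a + 1]`. -/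
theorem Dominant.eq_of_cfStep_mul_eq (hX : Dominant X) (hY : Dominant Y)
    (h : (cfStep a : Matrix (Fin 2) (Fin 2) ℤ) * X = cfStep b * Y) : a = b := by
  obtain ⟨h0, h1⟩ : (a * X 0 0 + X 1 0 = b * Y 0 0 + Y 1 0) ∧ X 0 0 = Y 0 0 := by
    simpa [cfStep, Matrix.mul_apply] using
      And.intro (congrFun (congrFun h 0) 0) (congrFun (congrFun h 1) 0)
  obtain ⟨x1, x2, -⟩ := hX
  obtain ⟨y1, y2, -⟩ := hY
  rw [← h1] at h0 y2
  rcases lt_trichotomy (a : ℤ) b with hlt | heq | hlt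
  · nlinarith
  · exact_mod_cast heq
  · nlinarith

theorem pow_mul_pow_ne_of_cfStep_ne (hab : a ≠ b) (ha : 1 ≤ a) (hb : 1 ≤ b)
    (hX : X ∈ dominantSubmonoid) (hY : Y ∈ dominantSubmonoid) {m : ℕ} (hm : 0 < m) :
    (cfStep a * X) ^ m * (cfStep b * Y) ^ m ≠ (cfStep b * Y) ^ m * (cfStep a * X) ^ m := by
  obtain ⟨m, rfl⟩ := Nat.exists_eq_add_of_le' hm
  have hA := (dominant_cfStep ha).mul_of_mem hX
  have hB := (dominant_cfStep hb).mul_of_mem hY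
  have hXA := mul_mem hX (pow_mem hA.mem m)
  have hYB := mul_mem hY (pow_mem hB.mem m)
  refine fun h => hab ((Dominant.mul_of_mem_left hXA (hB.pow_succ m)).eq_of_cfStep_mul_eq
    (Dominant.mul_of_mem_left hYB (hA.pow_succ m)) ?_)
  simpa only [_root_.pow_succ', mul_assoc] using h

theorem Dominant.two_lt_trace (hX : Dominant X) (hdet : X.det = 1) : 2 < X.trace := by
  obtain ⟨x1, x2, x3, x4, x5⟩ := hX
  rw [Matrix.det_fin_two] at hdet
  rw [Matrix.trace_fin_two]
  have h11 : 1 ≤ X 1 1 := by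
    by_contra hlt
    nlinarith
  by_contra hle
  have h00 : X 0 0 = 1 := by linarith
  nlinarith [h00]

theorem sq_sub_four_mul_sq_ne_sq {n s t : ℤ} (hn : 2 < |n|) (hs : s ≠ 0) :
    (n ^ 2 - 4) * s ^ 2 ≠ t ^ 2 := by
  intro h
  obtain ⟨r, rfl⟩ : s ∣ t := by
    rw [← Int.pow_dvd_pow_iff two_ne_zero]
    exact Dvd.intro_left _ h
  have hr : |n| ^ 2 - 4 = |r| ^ 2 := by
    rw [sq_abs, sq_abs]
    exact mul_right_cancel₀ (pow_ne_zero 2 hs) (by rw [h]; ring)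
  have hlt : |r| < |n| := lt_of_pow_lt_pow_left₀ 2 (abs_nonneg n) (by linarith)
  have hgt : |n| - 1 < |r| := lt_of_pow_lt_pow_left₀ 2 (abs_nonneg r) (by nlinarith)
  omega

/-- Hyperbolic matrices have irrational eigenvalues, so they have no common eigenvector with a
matrix which they do not commute with. -/
theorem det_mul_sub_mul_ne_zero (hdet : X.det = 1) (htr : 2 < |X.trace|) (hne : X * Y ≠ Y * X) :
    (X * Y - Y * X).det ≠ 0 := by
  intro h
  set C := X * Y - Y * X with hC
  have hC11 : C 1 1 = - C 0 0 := by
    simp only [hC, Matrix.sub_apply, Matrix.mul_apply, Fin.sum_univ_two]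
    ring
  have htrace : C 0 0 * (X 0 0 - X 1 1) + C 0 1 * X 1 0 + C 1 0 * X 0 1 = 0 := by
    simp only [hC, Matrix.sub_apply, Matrix.mul_apply, Fin.sum_univ_two]
    ring
  have hdisc : X.trace ^ 2 - 4 = (X 0 0 - X 1 1) ^ 2 + 4 * (X 0 1 * X 1 0) := by
    rw [Matrix.trace_fin_two]
    rw [Matrix.det_fin_two] at hdet
    linear_combination 4 * hdet
  rw [Matrix.det_fin_two, hC11] at h
  have hC00 : C 0 0 = 0 := by
    by_contra h0
    apply sq_sub_four_mul_sq_ne_sq htr h0 (t := C 0 1 * X 1 0 - C 1 0 * X 0 1)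
    rw [hdisc]
    linear_combination (C 0 0 * (X 0 0 - X 1 1) - C 0 1 * X 1 0 - C 1 0 * X 0 1) * htrace -
      4 * X 0 1 * X 1 0 * h
  have hX : X 0 1 * X 1 0 ≠ 0 := fun h0 =>
    sq_sub_four_mul_sq_ne_sq htr one_ne_zero (t := X 0 0 - X 1 1) (by rw [hdisc, h0]; ring)
  obtain ⟨hX01, hX10⟩ := mul_ne_zero_iff.mp hX
  rw [hC00] at h htrace
  obtain ⟨hC01, hC10⟩ : C 0 1 = 0 ∧ C 1 0 = 0 := by
    rcases mul_eq_zero.mp (show C 0 1 * C 1 0 = 0 by linarith) with h0 | h0 <;>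
      simp_all
  apply hne
  rw [← sub_eq_zero, ← hC]
  ext i j
  fin_cases i <;> fin_cases j <;> simp [hC00, hC01, hC10, hC11]

section CommRing

variable {R : Type*} [CommRing R]

/-- The determinant of two plane vectors. -/
def wedge (u v : Fin 2 → R) : R := u 0 * v 1 - u 1 * v 0

theorem dvd_of_isCoprime_of_forall_dvd_mul {N d : R} {u : Fin 2 → R} (hu : IsCoprime (u 0) (u 1))
    (h : ∀ i, N ∣ d * u i) : N ∣ d := by
  obtain ⟨r, s, hrs⟩ := hu
  rw [show d = r * (d * u 0) + s * (d * u 1) by linear_combination -d * hrs]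
  exact dvd_add ((h 0).mul_left r) ((h 1).mul_left s)

theorem exists_eq_smul_of_wedge_eq_zero {u v : Fin 2 → R} (hu : IsCoprime (u 0) (u 1))
    (h : wedge u v = 0) : ∃ r : R, v = r • u := by
  obtain ⟨r, s, hrs⟩ := hu
  unfold wedge at h
  refine ⟨r * v 0 + s * v 1, funext fun i => ?_⟩
  fin_cases i
  · simp only [Fin.zero_eta, Pi.smul_apply, smul_eq_mul]
    linear_combination -v 0 * hrs - s * h
  · simp only [Fin.mk_one, Pi.smul_apply, smul_eq_mul]
    linear_combination -v 1 * hrs + r * h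

theorem det_mul_sub_mul_eq_zero {X Y : Matrix (Fin 2) (Fin 2) R} {u : Fin 2 → R}
    (hu : IsCoprime (u 0) (u 1)) (hX : wedge u (u ᵥ* X) = 0) (hY : wedge u (u ᵥ* Y) = 0) :
    (X * Y - Y * X).det = 0 := by
  obtain ⟨l, hl⟩ := exists_eq_smul_of_wedge_eq_zero hu hX
  obtain ⟨m, hm⟩ := exists_eq_smul_of_wedge_eq_zero hu hY
  have hC : u ᵥ* (X * Y - Y * X) = 0 := by
    rw [vecMul_sub, ← vecMul_vecMul, ← vecMul_vecMul, hl, hm, smul_vecMul, smul_vecMul, hl, hm,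
      smul_comm, sub_self]
  have hsmul : (X * Y - Y * X).det • u = 0 := by
    rw [← vecMul_one u, ← vecMul_smul, ← mul_adjugate, ← vecMul_vecMul, hC, zero_vecMul]
  exact zero_dvd_iff.mp (dvd_of_isCoprime_of_forall_dvd_mul hu fun i =>
    zero_dvd_iff.mpr (congrFun hsmul i))

theorem pow_add_two_eq_of_det_eq_one {X : Matrix (Fin 2) (Fin 2) R} (hdet : X.det = 1) (m : ℕ) :
    X ^ (m + 2) = X.trace • X ^ (m + 1) - X ^ m := by
  have hsq : X ^ 2 = X.trace • X - 1 := by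
    have h := X.aeval_self_charpoly
    nontriviality R
    simp only [charpoly_fin_two, hdet, map_add, map_sub, map_mul, map_pow, Polynomial.aeval_X,
      Polynomial.aeval_C, map_one, ← Algebra.smul_def] at h
    rw [← sub_eq_zero, ← h]
    abel
  rw [pow_add, hsq, mul_sub, mul_one, Matrix.mul_smul, pow_succ]

theorem map_wedge {S : Type*} [CommRing S] (f : R →+* S) (u v : Fin 2 → R) :
    f (wedge u v) = wedge (f ∘ u) (f ∘ v) := by
  simp [wedge]

end CommRing

theorem dvd_det_mul_sub_mul {N : ℕ} {u : Fin 2 → ℤ} (hu : IsCoprime (u 0) (u 1))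
    (hX : (N : ℤ) ∣ wedge u (u ᵥ* X)) (hY : (N : ℤ) ∣ wedge u (u ᵥ* Y)) :
    (N : ℤ) ∣ (X * Y - Y * X).det := by
  let f := Int.castRingHom (ZMod N)
  have hwedge : ∀ Z : Matrix (Fin 2) (Fin 2) ℤ, (N : ℤ) ∣ wedge u (u ᵥ* Z) →
      wedge (f ∘ u) ((f ∘ u) ᵥ* f.mapMatrix Z) = 0 := by
    intro Z hZ
    rw [← ZMod.intCast_zmod_eq_zero_iff_dvd, ← eq_intCast f, map_wedge] at hZ
    rw [← hZ]
    congr 1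
    ext i
    exact (RingHom.map_vecMul f Z u i).symm
  rw [← ZMod.intCast_zmod_eq_zero_iff_dvd, ← eq_intCast f, RingHom.map_det, map_sub, map_mul,
    map_mul]
  exact det_mul_sub_mul_eq_zero (hu.map f) (hwedge X hX) (hwedge Y hY)

theorem vecMul_modEq_of_map_eq {q : ℕ}
    (h : X.map (Int.castRingHom (ZMod q)) = Y.map (Int.castRingHom (ZMod q))) (z : Fin 2 → ℤ)
    (i : Fin 2) : (z ᵥ* X) i ≡ (z ᵥ* Y) i [ZMOD q] := by
  rw [← ZMod.intCast_eq_intCast_iff, ← eq_intCast (Int.castRingHom (ZMod q)),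
    ← eq_intCast (Int.castRingHom (ZMod q)), RingHom.map_vecMul, RingHom.map_vecMul, h]

theorem exists_pow_eq_coe_mem_Gamma (N : ℕ) [NeZero N] :
    ∃ M, 0 < M ∧ ∀ A : GL (Fin 2) ℤ,
      ∃ γ ∈ Gamma N, (γ : Matrix (Fin 2) (Fin 2) ℤ) = (A : Matrix (Fin 2) (Fin 2) ℤ) ^ M := by
  refine ⟨2 * Nat.card (GL (Fin 2) (ZMod N)), mul_pos two_pos Nat.card_pos, fun A => ?_⟩
  set n := Nat.card (GL (Fin 2) (ZMod N))
  have hdet : (↑(A ^ (2 * n)) : Matrix (Fin 2) (Fin 2) ℤ).det = 1 := by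
    rw [Units.val_pow_eq_pow_val, det_pow, pow_mul,
      Int.isUnit_sq ((isUnit_iff_isUnit_det _).mp A.isUnit), one_pow]
  have hmap : GeneralLinearGroup.map (Int.castRingHom (ZMod N)) (A ^ (2 * n)) = 1 := by
    rw [map_pow, mul_comm, pow_mul, pow_card_eq_one', one_pow]
  refine ⟨(⟨_, hdet⟩ : SpecialLinearGroup (Fin 2) ℤ), Gamma_mem'.mpr ?_,
    Units.val_pow_eq_pow_val A _⟩
  ext i j
  exact congrArg (fun B : GL (Fin 2) (ZMod N) => B i j) hmap

theorem dvd_trace_sub_two_of_mem_Gamma {N : ℕ} {γ : SpecialLinearGroup (Fin 2) ℤ}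
    (hγ : γ ∈ Gamma N) : (N : ℤ) ∣ (γ : Matrix (Fin 2) (Fin 2) ℤ).trace - 2 := by
  obtain ⟨h00, -, -, h11⟩ := Gamma_mem.mp hγ
  rw [← ZMod.intCast_zmod_eq_zero_iff_dvd, trace_fin_two]
  push_cast
  rw [h00, h11]
  ring

end Matrices

section Arithmetic

open Matrix CongruenceSubgroup

theorem dvd_sub_affine_of_rec {R : Type*} [CommRing R] {D P t : R} (ht : P ∣ t - 2) {f : ℕ → R}
    (hrec : ∀ m, f (m + 2) = t * f (m + 1) - f m) (h0 : D ∣ f 0) (h1 : D ∣ f 1) (m : ℕ) :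
    D * P ∣ f m - (f 0 + m * (f 1 - f 0)) := by
  have hD : ∀ m, D ∣ f m ∧ D ∣ f (m + 1) := by
    intro m
    induction m with
    | zero => exact ⟨h0, h1⟩
    | succ m ih =>
      rw [hrec]
      exact ⟨ih.2, dvd_sub (ih.2.mul_left t) ih.1⟩
  induction m using Nat.twoStepInduction with
  | zero => simp
  | one => simp
  | more m ih₀ ih₁ =>
    have h := dvd_sub (dvd_add ((mul_comm D P).symm ▸ mul_dvd_mul ht (hD m).2) (ih₁.mul_left 2)) ih₀
    convert h using 1
    rw [hrec]
    push_cast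
    ring

theorem exists_lt_dvd_add_mul {p : ℕ} [Fact p.Prime] {v : ℤ} (hv : ¬ (p : ℤ) ∣ v) (u : ℤ) :
    ∃ j < p, (p : ℤ) ∣ u + j * v := by
  have hv0 : (v : ZMod p) ≠ 0 := mt (ZMod.intCast_zmod_eq_zero_iff_dvd v p).mp hv
  refine ⟨(-(u : ZMod p) / v).val, ZMod.val_lt _, ?_⟩
  rw [← ZMod.intCast_zmod_eq_zero_iff_dvd]
  push_cast
  rw [ZMod.natCast_zmod_val, div_mul_cancel₀ _ hv0, add_neg_cancel]

variable {p : ℕ} [Fact p.Prime] {e : ℕ}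

theorem exists_lt_pow_dvd_of_affine {f : ℕ → ℤ}
    (hf : ∀ m, (p : ℤ) ^ (e + 2) ∣ f m - (f 0 + m * (f 1 - f 0)))
    (h0 : (p : ℤ) ^ (e + 1) ∣ f 0) (h1 : emultiplicity (p : ℤ) (f 1) = e) :
    ∃ j < p, (p : ℤ) ^ (e + 2) ∣ f (p * j) ∧
      emultiplicity (p : ℤ) (f (p * (j + 1))) = (e + 1 : ℕ) := by
  obtain ⟨⟨v, hv⟩, hv'⟩ := emultiplicity_eq_coe.mp h1
  obtain ⟨u, hu⟩ := h0
  have hp0 : (p : ℤ) ^ (e + 1) ≠ 0 := pow_ne_zero _ (by exact_mod_cast (Fact.out : p.Prime).ne_zero)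
  have hpv : ¬ (p : ℤ) ∣ v := by
    rintro ⟨v, rfl⟩
    exact hv' ⟨v, by rw [hv]; ring⟩
  have hmul : ∀ j : ℕ, (p : ℤ) ^ (e + 2) ∣ f (p * j) - (p : ℤ) ^ (e + 1) * (u + j * v) := by
    intro j
    rw [show f (p * j) - (p : ℤ) ^ (e + 1) * (u + j * v) =
        f (p * j) - (f 0 + (p * j : ℕ) * (f 1 - f 0)) - (p : ℤ) ^ (e + 2) * (j * u) by
      rw [hu, hv]
      push_cast
      ring]
    exact dvd_sub (hf (p * j)) (dvd_mul_right _ _)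
  have hiff : ∀ j : ℕ, (p : ℤ) ^ (e + 2) ∣ f (p * j) ↔ (p : ℤ) ∣ u + j * v := by
    intro j
    rw [← mul_dvd_mul_iff_left hp0 (b := (p : ℤ)), ← pow_succ]
    exact dvd_iff_dvd_of_dvd_sub (hmul j)
  obtain ⟨j, hjp, hj⟩ := exists_lt_dvd_add_mul hpv u
  refine ⟨j, hjp, (hiff j).mpr hj, emultiplicity_eq_coe.mpr ⟨?_, fun h => hpv ?_⟩⟩
  · exact (dvd_iff_dvd_of_dvd_sub ((pow_dvd_pow (p : ℤ) (Nat.le_succ _)).trans (hmul (j + 1)))).mpr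
      (dvd_mul_right _ _)
  · have := dvd_sub ((hiff (j + 1)).mp h) hj
    rwa [show u + (j + 1 : ℕ) * v - (u + j * v) = v by push_cast; ring] at this

theorem exists_lt_pow_dvd_vecMul_pow {γ : SpecialLinearGroup (Fin 2) ℤ} (hγ : γ ∈ Gamma (p ^ 2))
    {u z : Fin 2 → ℤ} (h0 : (p : ℤ) ^ (e + 1) ∣ u ⬝ᵥ z)
    (h1 : emultiplicity (p : ℤ) (u ᵥ* γ ⬝ᵥ z) = e) :
    ∃ j < p, (p : ℤ) ^ (e + 2) ∣ u ᵥ* (γ : Matrix (Fin 2) (Fin 2) ℤ) ^ (p * j) ⬝ᵥ z ∧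
      emultiplicity (p : ℤ) (u ᵥ* (γ : Matrix (Fin 2) (Fin 2) ℤ) ^ (p * (j + 1)) ⬝ᵥ z) =
        (e + 1 : ℕ) := by
  let f : ℕ → ℤ := fun m => u ᵥ* (γ : Matrix (Fin 2) (Fin 2) ℤ) ^ m ⬝ᵥ z
  have hf0 : f 0 = u ⬝ᵥ z := by simp [f]
  have hf1 : f 1 = u ᵥ* γ ⬝ᵥ z := by simp [f]
  have hrec : ∀ m, f (m + 2) = (γ : Matrix (Fin 2) (Fin 2) ℤ).trace * f (m + 1) - f m := by
    intro m
    simp only [f]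
    rw [pow_add_two_eq_of_det_eq_one γ.det_coe, vecMul_sub, vecMul_smul, sub_dotProduct,
      smul_dotProduct, smul_eq_mul]
  have haffine : ∀ m : ℕ, (p : ℤ) ^ (e + 2) ∣ f m - (f 0 + m * (f 1 - f 0)) := by
    intro m
    rw [pow_add]
    refine dvd_sub_affine_of_rec (by exact_mod_cast dvd_trace_sub_two_of_mem_Gamma hγ) hrec ?_ ?_ m
    · exact hf0 ▸ (pow_dvd_pow _ (Nat.le_succ e)).trans h0
    · exact hf1 ▸ (emultiplicity_eq_coe.mp h1).1
  exact exists_lt_pow_dvd_of_affine haffine (hf0.symm ▸ h0) (hf1.symm ▸ h1)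

/-- Along the powers of `γ` the form `z` is affine modulo a higher power of `p`, hence it has
arbitrarily small values, as in Hensel's lemma. -/
theorem exists_pow_dvd_vecMul_pow (p : ℕ) [Fact p.Prime] (K : ℕ) :
    ∃ M : ℕ, ∀ γ ∈ Gamma (p ^ 2), ∀ (u z : Fin 2 → ℤ) (e : ℕ),
      (p : ℤ) ^ (e + 1) ∣ u ⬝ᵥ z → emultiplicity (p : ℤ) (u ᵥ* γ ⬝ᵥ z) = e →
      ∃ m₁ m₂, m₁ < m₂ ∧ m₂ ≤ M ∧
        (p : ℤ) ^ (e + K) ∣ u ᵥ* (γ : Matrix (Fin 2) (Fin 2) ℤ) ^ m₁ ⬝ᵥ z ∧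
        (p : ℤ) ^ (e + K) ∣ u ᵥ* (γ : Matrix (Fin 2) (Fin 2) ℤ) ^ m₂ ⬝ᵥ z := by
  induction K with
  | zero =>
    refine ⟨1, fun γ _ u z e h0 h1 => ⟨0, 1, zero_lt_one, le_rfl, ?_, ?_⟩⟩
    · simpa using (pow_dvd_pow _ (Nat.le_succ e)).trans h0
    · simpa using (emultiplicity_eq_coe.mp h1).1
  | succ K ih =>
    obtain ⟨M, hM⟩ := ih
    refine ⟨p * p + p * M, fun γ hγ u z e h0 h1 => ?_⟩
    have hp : 0 < p := (Fact.out : p.Prime).pos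
    obtain ⟨j, hjp, hj, hj'⟩ := exists_lt_pow_dvd_vecMul_pow hγ h0 h1
    have hcomp : ∀ m, u ᵥ* (γ : Matrix (Fin 2) (Fin 2) ℤ) ^ (p * j) ᵥ*
        ((γ : Matrix (Fin 2) (Fin 2) ℤ) ^ p) ^ m =
          u ᵥ* (γ : Matrix (Fin 2) (Fin 2) ℤ) ^ (p * j + p * m) := by
      intro m
      rw [vecMul_vecMul, ← pow_mul, ← pow_add]
    have hM' := hM (γ ^ p) (pow_mem hγ p) (u ᵥ* (γ : Matrix (Fin 2) (Fin 2) ℤ) ^ (p * j)) z (e + 1)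
    rw [vecMul_vecMul, Matrix.SpecialLinearGroup.coe_pow, ← pow_add, ← Nat.mul_succ] at hM'
    simp only [hcomp] at hM'
    obtain ⟨m₁, m₂, hlt, hle, hd₁, hd₂⟩ := hM' hj hj'
    rw [add_right_comm] at hd₁ hd₂
    refine ⟨p * j + p * m₁, p * j + p * m₂, ?_, ?_, hd₁, hd₂⟩
    · gcongr
    · gcongr

/-- The `ℓ¹` norm of a plane vector. It measures the size of integral linear forms. -/
def l1Norm (z : Fin 2 → ℤ) : ℤ := |z 0| + |z 1|

theorem exists_dvd_dotProduct_l1Norm_sq_le (N : ℕ) [NeZero N] (u : Fin 2 → ℤ) :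
    ∃ z : Fin 2 → ℤ, z ≠ 0 ∧ (N : ℤ) ∣ u ⬝ᵥ z ∧ l1Norm z ^ 2 ≤ 4 * (N : ℤ) := by
  set k := N.sqrt
  let g : Fin (k + 1) × Fin (k + 1) → ZMod N := fun x =>
    (u 0 : ZMod N) * (x.1 : ℕ) + (u 1 : ZMod N) * (x.2 : ℕ)
  obtain ⟨x, y, hxy, hg⟩ := Fintype.exists_ne_map_eq_of_card_lt g (by
    rw [ZMod.card, Fintype.card_prod, Fintype.card_fin]
    exact Nat.lt_succ_sqrt N)
  refine ⟨![(x.1 : ℕ) - (y.1 : ℕ), (x.2 : ℕ) - (y.2 : ℕ)], fun h => hxy ?_, ?_, ?_⟩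
  · have h0 := congrFun h 0
    have h1 := congrFun h 1
    simp only [cons_val_zero, cons_val_one, Pi.zero_apply] at h0 h1
    ext <;> omega
  · rw [← ZMod.intCast_zmod_eq_zero_iff_dvd, ← sub_eq_zero.mpr hg]
    simp only [dotProduct, Fin.sum_univ_two, cons_val_zero, cons_val_one, g]
    push_cast
    ring
  · have habs : ∀ i j : Fin (k + 1), |((i : ℕ) : ℤ) - (j : ℕ)| ≤ k := fun i j => by
      rw [abs_le]
      omega
    have hk : (k : ℤ) * k ≤ N := by exact_mod_cast Nat.sqrt_le N
    calc l1Norm ![(x.1 : ℕ) - (y.1 : ℕ), (x.2 : ℕ) - (y.2 : ℕ)] ^ 2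
        ≤ (k + k : ℤ) ^ 2 := pow_le_pow_left₀ (add_nonneg (abs_nonneg _) (abs_nonneg _))
          (add_le_add (habs _ _) (habs _ _)) 2
      _ ≤ 4 * N := by linarith [sq (k + k : ℤ)]

theorem exists_eq_pow_smul_not_dvd {ι : Type*} {z : ι → ℤ} (hz : z ≠ 0) :
    ∃ (b : ℕ) (y : ι → ℤ), z = (p : ℤ) ^ b • y ∧ ¬ ∀ i, (p : ℤ) ∣ y i := by
  classical
  obtain ⟨i, hi⟩ := Function.ne_iff.mp hz
  obtain ⟨n, hn⟩ : FiniteMultiplicity (p : ℤ) (z i) :=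
    Int.finiteMultiplicity_iff.mpr ⟨by simpa using (Fact.out : p.Prime).ne_one, hi⟩
  have hex : ∃ n, ¬ ∀ i, (p : ℤ) ^ n ∣ z i := ⟨n + 1, fun h => hn (h i)⟩
  obtain ⟨b, hb⟩ := Nat.exists_eq_add_one_of_ne_zero
    (mt (Nat.find_eq_zero hex).mp fun h => h fun i => by rw [pow_zero]; exact one_dvd _)
  have hdvd : ∀ i, (p : ℤ) ^ b ∣ z i := not_not.mp (Nat.find_min hex (hb ▸ Nat.lt_succ_self b))
  choose y hy using hdvd
  refine ⟨b, y, funext hy, fun h => Nat.find_spec hex fun i => ?_⟩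
  rw [hb, hy i, pow_succ]
  exact mul_dvd_mul_left _ (h i)

theorem emultiplicity_dotProduct_eq {u v z : Fin 2 → ℤ} (hz : ¬ ∀ i, (p : ℤ) ∣ z i)
    (hu : IsCoprime (u 0) (u 1)) (huv : emultiplicity (p : ℤ) (wedge u v) = e)
    (hzu : (p : ℤ) ^ (e + 1) ∣ u ⬝ᵥ z) : emultiplicity (p : ℤ) (v ⬝ᵥ z) = e := by
  have h0 : v ⬝ᵥ z * u 0 = v 0 * (u ⬝ᵥ z) + wedge u v * z 1 := by
    simp only [dotProduct, Fin.sum_univ_two, wedge]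
    ring
  have h1 : v ⬝ᵥ z * u 1 = v 1 * (u ⬝ᵥ z) - wedge u v * z 0 := by
    simp only [dotProduct, Fin.sum_univ_two, wedge]
    ring
  have hpe := (emultiplicity_eq_coe.mp huv).1
  have hzu' := (pow_dvd_pow (p : ℤ) (Nat.le_succ e)).trans hzu
  refine emultiplicity_eq_coe.mpr ⟨dvd_of_isCoprime_of_forall_dvd_mul hu ?_, fun h => hz ?_⟩
  · rw [Fin.forall_fin_two, h0, h1]
    exact ⟨dvd_add (hzu'.mul_left _) (hpe.mul_right _), dvd_sub (hzu'.mul_left _) (hpe.mul_right _)⟩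
  · have hcancel : ∀ s : ℤ, (p : ℤ) ^ (e + 1) ∣ wedge u v * s → (p : ℤ) ∣ s := by
      intro s hs
      by_contra hps
      have := emultiplicity_mul (a := wedge u v) (b := s)
        (Nat.prime_iff_prime_int.mp (Fact.out : p.Prime))
      rw [huv, emultiplicity_eq_zero.mpr hps, add_zero] at this
      exact (emultiplicity_eq_coe.mp this).2 hs
    rw [Fin.forall_fin_two]
    exact ⟨hcancel _ ((dvd_sub_right (hzu.mul_left (v 1))).mp (h1 ▸ h.mul_right (u 1))),
      hcancel _ ((dvd_add_right (hzu.mul_left (v 0))).mp (h0 ▸ h.mul_right (u 0)))⟩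

end Arithmetic

section BadWords

open Matrix CongruenceSubgroup

theorem l1Norm_smul (k : ℤ) (z : Fin 2 → ℤ) : l1Norm (k • z) = |k| * l1Norm z := by
  simp only [l1Norm, Pi.smul_apply, smul_eq_mul, abs_mul, mul_add]

theorem l1Norm_nonneg (z : Fin 2 → ℤ) : 0 ≤ l1Norm z := add_nonneg (abs_nonneg _) (abs_nonneg _)

theorem l1Norm_le_of_dotProduct_eq_zero {u z : Fin 2 → ℤ} (hu : IsCoprime (u 0) (u 1)) (hz : z ≠ 0)
    (h : u ⬝ᵥ z = 0) : l1Norm u ≤ l1Norm z := by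
  obtain ⟨k, rfl⟩ := exists_eq_smul_of_wedge_eq_zero (u := ![-u 1, u 0]) (v := z)
    (by simpa using hu.symm.neg_left) (by
      rw [wedge, ← neg_eq_zero, ← h]
      simp only [dotProduct, Fin.sum_univ_two, cons_val_zero, cons_val_one]
      ring)
  have hk : k ≠ 0 := by
    rintro rfl
    exact hz (zero_smul _ _)
  calc l1Norm u = l1Norm ![-u 1, u 0] := by simp [l1Norm, add_comm]
    _ ≤ |k| * l1Norm ![-u 1, u 0] := le_mul_of_one_le_left (l1Norm_nonneg _) (Int.one_le_abs hk)
    _ = l1Norm (k • ![-u 1, u 0]) := (l1Norm_smul _ _).symm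

theorem wedge_eq_zero_of_dotProduct_eq_zero {u v z : Fin 2 → ℤ} (hz : z ≠ 0) (hu : u ⬝ᵥ z = 0)
    (hv : v ⬝ᵥ z = 0) : wedge u v = 0 := by
  have hdet : (of ![u, v]).det = 0 := exists_mulVec_eq_zero_iff.mp ⟨z, hz, funext fun i => by
    fin_cases i
    exacts [hu, hv]⟩
  rwa [det_fin_two] at hdet

/-- The row vector `(qₙ, qₙ₋₁)` of the denominators of two consecutive convergents of a continued
fraction with partial quotients `a 0, a 1, …`, starting from `(q₀, q₋₁) = (1, 0)`. -/
def denVec (a : ℕ → ℕ) (n : ℕ) : Fin 2 → ℤ :=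
  ![1, 0] ᵥ* (((block a 0 n).map cfStep).prod : Matrix (Fin 2) (Fin 2) ℤ)

variable {a : ℕ → ℕ} {m n : ℕ}

theorem denVec_zero (a : ℕ → ℕ) : denVec a 0 = ![1, 0] := by simp [denVec, block]

theorem denVec_add (a : ℕ → ℕ) (n d : ℕ) : denVec a (n + d) =
    denVec a n ᵥ* (((block a n d).map cfStep).prod : Matrix (Fin 2) (Fin 2) ℤ) := by
  rw [denVec, block_add, List.map_append, List.prod_append, Units.val_mul, ← vecMul_vecMul,
    zero_add, denVec]

theorem denVec_succ (a : ℕ → ℕ) (n : ℕ) :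
    denVec a (n + 1) = ![a n * denVec a n 0 + denVec a n 1, denVec a n 0] := by
  rw [denVec_add]
  ext i
  fin_cases i <;> simp [block, cfStep, vecMul, dotProduct, mul_comm]

theorem denVec_succ_one (a : ℕ → ℕ) (n : ℕ) : denVec a (n + 1) 1 = denVec a n 0 := by
  rw [denVec_succ]
  rfl

theorem denVec_add_mul_of_agree {d k : ℕ} (h : Agree a (d * k) (n + d) n) :
    denVec a (n + d * k) =
      denVec a n ᵥ* (((block a n d).map cfStep).prod : Matrix (Fin 2) (Fin 2) ℤ) ^ k := by
  induction k with
  | zero => simp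
  | succ k ih =>
    have hk : Agree a (d * k) (n + d) n :=
      fun i hi => h i (hi.trans_le (Nat.mul_le_mul_left d k.le_succ))
    rw [Nat.mul_succ, ← add_assoc, denVec_add, ih hk, block_add_mul_of_agree hk, vecMul_vecMul,
      pow_succ]

theorem isCoprime_denVec (a : ℕ → ℕ) (n : ℕ) : IsCoprime (denVec a n 0) (denVec a n 1) := by
  induction n with
  | zero =>
    rw [denVec_zero]
    exact isCoprime_one_left
  | succ n ih =>
    rw [denVec_succ]
    exact IsCoprime.mul_add_right_left ih.symm _

theorem denVec_bounds (ha : ∀ n, 1 ≤ a n) (n : ℕ) :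
    0 < denVec a n 0 ∧ 0 ≤ denVec a n 1 ∧ denVec a n 1 ≤ denVec a n 0 := by
  induction n with
  | zero => simp [denVec_zero]
  | succ n ih =>
    have han : (1 : ℤ) ≤ a n := by exact_mod_cast ha n
    rw [denVec_succ]
    simp only [cons_val_zero, cons_val_one]
    refine ⟨?_, ih.1.le, ?_⟩ <;> nlinarith

theorem abs_denVec_dotProduct_le (ha : ∀ n, 1 ≤ a n) (n : ℕ) (z : Fin 2 → ℤ) :
    |denVec a n ⬝ᵥ z| ≤ denVec a n 0 * l1Norm z := by
  obtain ⟨h0, h1, hle⟩ := denVec_bounds ha n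
  rw [dotProduct, Fin.sum_univ_two, l1Norm, mul_add]
  refine (abs_add_le _ _).trans ?_
  rw [abs_mul, abs_mul, abs_of_pos h0, abs_of_nonneg h1]
  gcongr

theorem l1Norm_denVec (ha : ∀ n, 1 ≤ a n) (n : ℕ) :
    l1Norm (denVec a n) = denVec a n 0 + denVec a n 1 := by
  obtain ⟨h0, h1, -⟩ := denVec_bounds ha n
  rw [l1Norm, abs_of_pos h0, abs_of_nonneg h1]

theorem strictMono_l1Norm_denVec (ha : ∀ n, 1 ≤ a n) : StrictMono fun n => l1Norm (denVec a n) := by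
  refine strictMono_nat_of_lt_succ fun n => ?_
  have h0 := (denVec_bounds ha n).1
  have han : (1 : ℤ) ≤ a n := by exact_mod_cast ha n
  rw [l1Norm_denVec ha, l1Norm_denVec ha, denVec_succ]
  simp only [cons_val_zero, cons_val_one]
  nlinarith

theorem le_l1Norm_denVec (ha : ∀ n, 1 ≤ a n) (n : ℕ) : (n : ℤ) ≤ l1Norm (denVec a n) := by
  induction n with
  | zero => exact l1Norm_nonneg _
  | succ n ih =>
    push_cast
    exact Int.add_one_le_of_lt (ih.trans_lt (strictMono_l1Norm_denVec ha n.lt_succ_self))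

theorem wedge_denVec_ne_zero (ha : ∀ n, 1 ≤ a n) (hmn : m < n) :
    wedge (denVec a m) (denVec a n) ≠ 0 := by
  intro h
  obtain ⟨k, hk⟩ := exists_eq_smul_of_wedge_eq_zero (isCoprime_denVec a m) h
  have hunit : IsUnit k := (isCoprime_denVec a n).isUnit_of_dvd'
    ⟨denVec a m 0, congrFun hk 0⟩ ⟨denVec a m 1, congrFun hk 1⟩
  refine (strictMono_l1Norm_denVec ha hmn).ne ?_
  simp only [hk, l1Norm_smul, Int.isUnit_iff_abs_eq.mp hunit, one_mul]

/-- A word of positive letters such that a nonzero value of an integral form at two consecutive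
denominators of its convergents is divisible by a high power of `p` only if the form has large
coefficients. For the partial quotients of `x`, this expresses `c ≤ q |q|_p ‖q x‖`. -/
structure BadWord (p : ℕ) (a : ℕ → ℕ) (c : ℝ) : Prop where
  pos : ∀ n, 1 ≤ a n
  c_pos : 0 < c
  bad : ∀ (n : ℕ) (z : Fin 2 → ℤ) (K : ℕ), denVec a n ⬝ᵥ z ≠ 0 →
    (p : ℤ) ^ K ∣ denVec a n ⬝ᵥ z → c * (p : ℝ) ^ K ≤ (l1Norm z : ℝ) ^ 2

namespace BadWord

variable {p : ℕ} [hp : Fact p.Prime] {c : ℝ}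

theorem exists_lt_mul_pow (h : BadWord p a c) (y : ℝ) : ∃ B : ℕ, y < c * (p : ℝ) ^ B := by
  obtain ⟨B, hB⟩ := pow_unbounded_of_one_lt (y / c) (by exact_mod_cast hp.out.one_lt : (1 : ℝ) < p)
  exact ⟨B, by rwa [div_lt_iff₀' h.c_pos] at hB⟩

theorem mul_pow_le_four (h : BadWord p a c) {n b L : ℕ} {z : Fin 2 → ℤ}
    (hne : denVec a n ⬝ᵥ z ≠ 0) (hdvd : (p : ℤ) ^ (L - b) ∣ denVec a n ⬝ᵥ z)
    (hsize : ((p : ℤ) ^ b) ^ 2 * l1Norm z ^ 2 ≤ 4 * (p : ℤ) ^ L) : c * (p : ℝ) ^ b ≤ 4 := by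
  have hpR : (1 : ℝ) ≤ p := by exact_mod_cast hp.out.one_le
  have hbad := h.bad n z _ hne hdvd
  have hsizeR : ((p : ℝ) ^ b) ^ 2 * (l1Norm z : ℝ) ^ 2 ≤ 4 * (p : ℝ) ^ L := by
    exact_mod_cast hsize
  have hpow : (p : ℝ) ^ L ≤ (p : ℝ) ^ b * (p : ℝ) ^ (L - b) := by
    rw [← pow_add]
    exact pow_le_pow_right₀ hpR (by omega)
  have hpos : 0 < (p : ℝ) ^ b * (p : ℝ) ^ (L - b) := by positivity
  refine le_of_mul_le_mul_right ?_ hpos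
  calc c * (p : ℝ) ^ b * ((p : ℝ) ^ b * (p : ℝ) ^ (L - b))
      = ((p : ℝ) ^ b) ^ 2 * (c * (p : ℝ) ^ (L - b)) := by ring
    _ ≤ ((p : ℝ) ^ b) ^ 2 * (l1Norm z : ℝ) ^ 2 := by gcongr
    _ ≤ 4 * ((p : ℝ) ^ b * (p : ℝ) ^ (L - b)) := by linarith

theorem exists_not_dvd_form (h : BadWord p a c) {B : ℕ} (hB : 4 < c * (p : ℝ) ^ B) (n e : ℕ) :
    ∃ z : Fin 2 → ℤ, (¬ ∀ i, (p : ℤ) ∣ z i) ∧ (p : ℤ) ^ (e + 1) ∣ denVec a n ⬝ᵥ z ∧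
      l1Norm z ^ 2 ≤ 4 * (p : ℤ) ^ (e + 1 + B) := by
  have hp1 : (1 : ℤ) ≤ p := by exact_mod_cast hp.out.one_le
  have : NeZero (p ^ (e + 1 + B)) := ⟨pow_ne_zero _ hp.out.ne_zero⟩
  obtain ⟨z, hz, hdvd, hsize⟩ := exists_dvd_dotProduct_l1Norm_sq_le (p ^ (e + 1 + B)) (denVec a n)
  obtain ⟨b, y, rfl, hy⟩ := exists_eq_pow_smul_not_dvd (p := p) hz
  have hpb : (1 : ℤ) ≤ (p : ℤ) ^ b := one_le_pow₀ hp1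
  rw [l1Norm_smul, abs_of_pos (by linarith), mul_pow] at hsize
  push_cast at hsize hdvd
  refine ⟨y, hy, ?_, (le_mul_of_one_le_left (sq_nonneg _) (one_le_pow₀ hpb)).trans hsize⟩
  by_cases h0 : denVec a n ⬝ᵥ y = 0
  · rw [h0]
    exact dvd_zero _
  have hR : (p : ℤ) ^ (e + 1 + B - b) ∣ denVec a n ⬝ᵥ y := by
    refine (mul_dvd_mul_iff_left (by linarith : (p : ℤ) ^ b ≠ 0)).mp ?_
    rw [dotProduct_smul, smul_eq_mul] at hdvd
    rcases le_total b (e + 1 + B) with hb | hb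
    · rwa [← pow_add, Nat.add_sub_cancel' hb]
    · simp [Nat.sub_eq_zero_of_le hb]
  have hcb := h.mul_pow_le_four h0 hR hsize
  have hbB : b < B := by
    by_contra! hBb
    have : c * (p : ℝ) ^ B ≤ c * (p : ℝ) ^ b :=
      mul_le_mul_of_nonneg_left (pow_le_pow_right₀ (by exact_mod_cast hp1) hBb) h.c_pos.le
    linarith
  exact (pow_dvd_pow _ (by omega)).trans hR

theorem exists_form (h : BadWord p a c) : ∃ K M B : ℕ, ∀ (n e : ℕ), ∀ γ ∈ Gamma (p ^ 2),
    emultiplicity (p : ℤ) (wedge (denVec a n) (denVec a n ᵥ* γ)) = e →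
    ∃ z : Fin 2 → ℤ, z ≠ 0 ∧ l1Norm z ^ 2 ≤ 4 * (p : ℤ) ^ (e + B) ∧
      (∀ k, (p : ℤ) ^ (e + K) ∣ denVec a k ⬝ᵥ z → denVec a k ⬝ᵥ z = 0) ∧
      ∃ m₁ m₂, m₁ < m₂ ∧ m₂ ≤ M ∧
        (p : ℤ) ^ (e + K) ∣ denVec a n ᵥ* (γ : Matrix (Fin 2) (Fin 2) ℤ) ^ m₁ ⬝ᵥ z ∧
        (p : ℤ) ^ (e + K) ∣ denVec a n ᵥ* (γ : Matrix (Fin 2) (Fin 2) ℤ) ^ m₂ ⬝ᵥ z := by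
  obtain ⟨B, hB⟩ := h.exists_lt_mul_pow 4
  obtain ⟨K, hK⟩ := h.exists_lt_mul_pow (4 * (p : ℝ) ^ (1 + B))
  obtain ⟨M, hM⟩ := exists_pow_dvd_vecMul_pow p K
  refine ⟨K, M, 1 + B, fun n e γ hγ he => ?_⟩
  obtain ⟨z, hz, hdvd, hsize⟩ := h.exists_not_dvd_form hB n e
  refine ⟨z, ?_, by rwa [← add_assoc], fun k hk => ?_, hM γ hγ _ z e hdvd
    (emultiplicity_dotProduct_eq hz (isCoprime_denVec a n) he hdvd)⟩
  · rintro rfl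
    exact hz fun _ => dvd_zero _
  · by_contra h0
    have hpe : (0 : ℝ) < (p : ℝ) ^ e := pow_pos (by exact_mod_cast hp.out.pos) e
    have hsizeR : (l1Norm z : ℝ) ^ 2 ≤ 4 * (p : ℝ) ^ (e + 1 + B) := by exact_mod_cast hsize
    have hbad := (h.bad k z _ h0 hk).trans hsizeR
    rw [add_assoc, pow_add, pow_add] at hbad
    nlinarith

theorem uniformlyAperiodic (h : BadWord p a c) : UniformlyAperiodic a := by
  intro d hd
  obtain ⟨K, M, B, hform⟩ := h.exists_form
  have : NeZero (p ^ 2) := ⟨pow_ne_zero _ hp.out.ne_zero⟩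
  obtain ⟨M₀, hM₀, hpow⟩ := exists_pow_eq_coe_mem_Gamma (p ^ 2)
  refine ⟨d * (M₀ * (M + 1)), fun n hper => ?_⟩
  set A := ((block a n d).map cfStep).prod
  obtain ⟨γ, hγ, hγA⟩ := hpow A
  have hden : ∀ m ≤ M + 1, denVec a n ᵥ* (γ : Matrix (Fin 2) (Fin 2) ℤ) ^ m =
      denVec a (n + d * (M₀ * m)) := by
    intro m hm
    rw [hγA, ← pow_mul, denVec_add_mul_of_agree fun i hi => hper i (hi.trans_le ?_)]
    gcongr
  have hlt : ∀ {m m'}, m < m' → n + d * (M₀ * m) < n + d * (M₀ * m') := fun hmm =>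
    Nat.add_lt_add_left (Nat.mul_lt_mul_of_pos_left (Nat.mul_lt_mul_of_pos_left hmm hM₀) hd) n
  have hwedge : wedge (denVec a n) (denVec a n ᵥ* γ) ≠ 0 := by
    rw [← pow_one (γ : Matrix (Fin 2) (Fin 2) ℤ), hden 1 (by omega)]
    exact wedge_denVec_ne_zero h.pos (hlt zero_lt_one)
  have hmult : FiniteMultiplicity (p : ℤ) (wedge (denVec a n) (denVec a n ᵥ* γ)) :=
    Int.finiteMultiplicity_iff.mpr ⟨by simpa using hp.out.ne_one, hwedge⟩
  obtain ⟨z, hz, -, hzero, m₁, m₂, hlt₁₂, hle, hd₁, hd₂⟩ :=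
    hform n _ γ hγ hmult.emultiplicity_eq_multiplicity
  rw [hden _ (by omega)] at hd₁ hd₂
  exact wedge_denVec_ne_zero h.pos (hlt hlt₁₂)
    (wedge_eq_zero_of_dotProduct_eq_zero hz (hzero _ hd₁) (hzero _ hd₂))

theorem exists_pow_dvd_wedge (h : BadWord p a c) : ∃ K B : ℕ, ∀ E n, ∀ γ ∈ Gamma (p ^ 2),
    (∀ m, ∃ k, 4 * p ^ (E + B) < k ∧ ∀ i, denVec a k i ≡
      (denVec a n ᵥ* (γ : Matrix (Fin 2) (Fin 2) ℤ) ^ m) i [ZMOD (p ^ (E + K) : ℕ)]) →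
    (p : ℤ) ^ (E + 1) ∣ wedge (denVec a n) (denVec a n ᵥ* γ) := by
  obtain ⟨K, _, B, hform⟩ := h.exists_form
  refine ⟨K, B, fun E n γ hγ hk => ?_⟩
  by_contra hdvd
  obtain ⟨e, he⟩ : ∃ e : ℕ,
      emultiplicity (p : ℤ) (wedge (denVec a n) (denVec a n ᵥ* γ)) = e :=
    ⟨_, (FiniteMultiplicity.def.mpr ⟨E, hdvd⟩).emultiplicity_eq_multiplicity⟩
  have heE : e ≤ E := by
    by_contra! hlt
    exact hdvd ((pow_dvd_pow _ hlt).trans (emultiplicity_eq_coe.mp he).1)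
  obtain ⟨z, hz, hsize, hzero, m, -, -, -, hm, -⟩ := hform n e γ hγ he
  obtain ⟨k, hk, hcong⟩ := hk m
  have hkz : (p : ℤ) ^ (e + K) ∣ denVec a k ⬝ᵥ z := by
    have hcoord : ∀ i, (p : ℤ) ^ (e + K) ∣
        denVec a k i - (denVec a n ᵥ* (γ : Matrix (Fin 2) (Fin 2) ℤ) ^ m) i := fun i =>
      (pow_dvd_pow _ (Nat.add_le_add_right heE K)).trans (by simpa using (hcong i).symm.dvd)
    refine (dvd_iff_dvd_of_dvd_sub ?_).mpr hm
    rw [← sub_dotProduct]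
    exact Finset.dvd_sum fun i _ => (hcoord i).mul_right _
  have hpow : (p : ℤ) ^ (e + B) ≤ (p : ℤ) ^ (E + B) :=
    pow_le_pow_right₀ (by exact_mod_cast hp.out.one_le) (by omega)
  have hkR : 4 * (p : ℤ) ^ (E + B) < k := by exact_mod_cast hk
  linarith [hkR, le_l1Norm_denVec h.pos k, Int.le_self_sq (l1Norm z),
    l1Norm_le_of_dotProduct_eq_zero (isCoprime_denVec a k) hz (hzero k hkz)]

end BadWord

end BadWords

section LimitWords

open Matrix CongruenceSubgroup

variable {a w : ℕ → ℕ} {n₀ N l r c : ℕ} {u v : List ℕ}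

/-- Every prefix of `w` occurs in `a` at infinitely many positions, that is, `w` is a limit point of
the shifts of `a`. -/
def IsLimitWord (a w : ℕ → ℕ) : Prop := ∀ L, ∃ᶠ n in atTop, ∀ k < L, a (n + k) = w k

theorem IsLimitWord.range_subset (h : IsLimitWord a w) : Set.range w ⊆ Set.range a := by
  rintro _ ⟨k, rfl⟩
  obtain ⟨n, hn⟩ := (h (k + 1)).exists
  exact ⟨n + k, hn k k.lt_succ_self⟩

theorem IsLimitWord.uniformlyAperiodic (h : IsLimitWord a w) (ha : UniformlyAperiodic a) :
    UniformlyAperiodic w := by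
  intro d hd
  obtain ⟨L, hL⟩ := ha d hd
  refine ⟨L, fun m hm => ?_⟩
  obtain ⟨n, hn⟩ := (h (m + d + L)).exists
  refine hL (n + m) fun k hk => ?_
  rw [show n + m + d + k = n + (m + d + k) by ring, show n + m + k = n + (m + k) by ring,
    hn _ (by omega), hn _ (by omega), hm k hk]

theorem IsReturnWord.exists_eq_cfStep_mul (hu : IsReturnWord w N c u) (hw : ∀ n, 1 ≤ w n)
    (hex : ∃ i, RightSpecialAt w N i ∧ w i = c) : ∃ X ∈ dominantSubmonoid,
      (((u.map cfStep).prod : GL (Fin 2) ℤ) : Matrix (Fin 2) (Fin 2) ℤ) = cfStep c * X := by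
  obtain ⟨i, hi, rfl⟩ := hex
  obtain ⟨d, hd⟩ := Nat.exists_eq_add_of_lt hu.length_pos
  rw [← hu.block_eq i hi rfl, hd, zero_add, add_comm d, block_add]
  refine ⟨_, prod_map_cfStep_mem_dominantSubmonoid (u := block w (i + 1) d) ?_, by simp [block]⟩
  simp only [block, List.mem_map]
  rintro _ ⟨k, -, rfl⟩
  exact hw _

theorem IsLimitWord.exists_forall_mem_closure (hlim : IsLimitWord a w)
    (h : SpecialWord w n₀ l r) (hw : UniformlyAperiodic w) (hfin : (Set.range w).Finite)
    (hN : n₀ ≤ N) (hu : IsReturnWord w N l u) (hv : IsReturnWord w N r v) (q : ℕ) [NeZero q]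
    (R : ℕ) : ∃ k₀, ∀ g ∈ Subgroup.closure {(u.map cfStep).prod, (v.map cfStep).prod},
      ∃ k, R < k ∧ ∀ i,
        denVec a k i ≡ (denVec a k₀ ᵥ* (g : Matrix (Fin 2) (Fin 2) ℤ)) i [ZMOD q] := by
  let red : GL (Fin 2) ℤ →* GL (Fin 2) (ZMod q) :=
    GeneralLinearGroup.map (Int.castRingHom (ZMod q))
  obtain ⟨x, hx⟩ := h.exists_forall_mem_closure hw hfin (fun c => red (cfStep c)) hN hu hv
  have hprod : ∀ y : List ℕ, (y.map fun c => red (cfStep c)).prod = red (y.map cfStep).prod :=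
    fun y => by rw [← List.prod_hom, List.map_map]; rfl
  rw [hprod, hprod, ← Set.image_pair, ← MonoidHom.map_closure] at hx
  simp only [hprod] at hx
  choose! pos hpos using hx
  obtain ⟨L, hL⟩ := (Set.finite_range pos).bddAbove
  obtain ⟨n, hRn, hn⟩ := frequently_atTop.mp (hlim L) (R + 1)
  have hden : ∀ y, denVec a (n + pos y) = denVec a n ᵥ*
      (((block w 0 (pos y)).map cfStep).prod : Matrix (Fin 2) (Fin 2) ℤ) := fun y => by
    have hblock : block a n (pos y) = block w 0 (pos y) :=
      List.map_congr_left fun k hk => by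
        rw [hn k ((List.mem_range.mp hk).trans_le (hL ⟨y, rfl⟩)), zero_add]
    rw [denVec_add, hblock]
  refine ⟨n + pos 1, fun g hg => ⟨n + pos (red g), by omega, fun i => ?_⟩⟩
  have hred : red ((block w 0 (pos (red g))).map cfStep).prod =
      red (((block w 0 (pos 1)).map cfStep).prod * g) := by
    rw [hpos _ (Subgroup.mem_map_of_mem red hg), map_mul, hpos _ (one_mem _), mul_one]
  rw [hden, hden, vecMul_vecMul, ← Units.val_mul]
  exact vecMul_modEq_of_map_eq (congrArg Units.val hred) _ i

theorem SpecialWord.det_mul_sub_mul_ne_zero (h : SpecialWord w n₀ l r) (hw : ∀ n, 1 ≤ w n)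
    (hN : n₀ ≤ N) (hu : IsReturnWord w N l u) (hv : IsReturnWord w N r v) {M : ℕ} (hM : 0 < M)
    {X Y : Matrix (Fin 2) (Fin 2) ℤ} (hdet : X.det = 1)
    (hX : X = ((u.map cfStep).prod : Matrix (Fin 2) (Fin 2) ℤ) ^ M)
    (hY : Y = ((v.map cfStep).prod : Matrix (Fin 2) (Fin 2) ℤ) ^ M) :
    (X * Y - Y * X).det ≠ 0 := by
  obtain ⟨i, hi, rfl⟩ := h.exists_rightSpecialAt hN
  obtain ⟨j, hj, rfl⟩ := h.symm.exists_rightSpecialAt hN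
  obtain ⟨Z, hZ, huZ⟩ := hu.exists_eq_cfStep_mul hw ⟨i, hi, rfl⟩
  obtain ⟨W, hW, hvW⟩ := hv.exists_eq_cfStep_mul hw ⟨j, hj, rfl⟩
  rw [huZ] at hX
  rw [hvW] at hY
  have hdom : Dominant X := by
    obtain ⟨m, rfl⟩ := Nat.exists_eq_add_of_le' hM
    exact hX ▸ ((dominant_cfStep (hw i)).mul_of_mem hZ).pow_succ m
  refine PLC.det_mul_sub_mul_ne_zero hdet
    ((hdom.two_lt_trace hdet).trans_le (le_abs_self _)) ?_
  rw [hX, hY]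
  exact pow_mul_pow_ne_of_cfStep_ne h.ne (hw i) (hw j) hZ hW hM

namespace BadWord

variable {p : ℕ} [hp : Fact p.Prime] {c : ℝ}

theorem det_mul_sub_mul_eq_zero (h : BadWord p a c) (hlim : IsLimitWord a w)
    (hspecial : SpecialWord w n₀ l r) (hw : UniformlyAperiodic w) (hfin : (Set.range w).Finite)
    (hN : n₀ ≤ N) (hu : IsReturnWord w N l u) (hv : IsReturnWord w N r v) {M : ℕ}
    {γ δ : SpecialLinearGroup (Fin 2) ℤ} (hγ : γ ∈ Gamma (p ^ 2)) (hδ : δ ∈ Gamma (p ^ 2))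
    (hγu : (γ : Matrix (Fin 2) (Fin 2) ℤ) = ((u.map cfStep).prod : Matrix _ _ ℤ) ^ M)
    (hδv : (δ : Matrix (Fin 2) (Fin 2) ℤ) = ((v.map cfStep).prod : Matrix _ _ ℤ) ^ M) :
    ((γ : Matrix (Fin 2) (Fin 2) ℤ) * δ - δ * γ).det = 0 := by
  by_contra hdet
  obtain ⟨E, hE⟩ : FiniteMultiplicity (p : ℤ) ((γ : Matrix (Fin 2) (Fin 2) ℤ) * δ - δ * γ).det :=
    Int.finiteMultiplicity_iff.mpr ⟨by simpa using hp.out.ne_one, hdet⟩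
  obtain ⟨K, R, hdvd⟩ := h.exists_pow_dvd_wedge
  have : NeZero (p ^ (E + K)) := ⟨pow_ne_zero _ hp.out.ne_zero⟩
  obtain ⟨k₀, hk₀⟩ := hlim.exists_forall_mem_closure hspecial hw hfin hN hu hv
    (p ^ (E + K)) (4 * p ^ (E + R))
  have hwedge : ∀ A ∈ ({(u.map cfStep).prod, (v.map cfStep).prod} : Set (GL (Fin 2) ℤ)),
      ∀ η ∈ Gamma (p ^ 2), (η : Matrix (Fin 2) (Fin 2) ℤ) = (A : Matrix (Fin 2) (Fin 2) ℤ) ^ M →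
      ((p ^ (E + 1) : ℕ) : ℤ) ∣ wedge (denVec a k₀) (denVec a k₀ ᵥ* η) := by
    intro A hA η hη hηA
    rw [Nat.cast_pow]
    refine hdvd E k₀ η hη fun m => ?_
    rw [hηA, ← pow_mul, ← Units.val_pow_eq_pow_val]
    exact hk₀ _ (pow_mem (Subgroup.subset_closure hA) _)
  have hdiv := dvd_det_mul_sub_mul (isCoprime_denVec a k₀)
    (hwedge _ (Set.mem_insert _ _) γ hγ hγu) (hwedge _ (Set.mem_insert_of_mem _ rfl) δ hδ hδv)
  exact hE (by rwa [Nat.cast_pow] at hdiv)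

theorem tendsto_complexity (h : BadWord p a c) (hfin : (Set.range a).Finite)
    (hlim : IsLimitWord a w) :
    Tendsto (fun n : ℕ => (complexity w n : ℤ) - (n : ℤ)) atTop atTop := by
  by_contra hbdd
  have hw := hlim.uniformlyAperiodic h.uniformlyAperiodic
  have hwfin := hfin.subset hlim.range_subset
  have hpos : ∀ n, 1 ≤ w n := fun n => by
    obtain ⟨m, hm⟩ := hlim.range_subset ⟨n, rfl⟩
    exact hm ▸ h.pos m
  obtain ⟨n₀, l, r, hspecial⟩ := hw.exists_specialWord hwfin hbdd
  obtain ⟨u, hu⟩ := hspecial.exists_isReturnWord hw hwfin le_rfl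
  obtain ⟨v, hv⟩ := hspecial.symm.exists_isReturnWord hw hwfin le_rfl
  have : NeZero (p ^ 2) := ⟨pow_ne_zero _ hp.out.ne_zero⟩
  obtain ⟨M, hM, hpow⟩ := exists_pow_eq_coe_mem_Gamma (p ^ 2)
  obtain ⟨γ, hγ, hγu⟩ := hpow (u.map cfStep).prod
  obtain ⟨δ, hδ, hδv⟩ := hpow (v.map cfStep).prod
  exact hspecial.det_mul_sub_mul_ne_zero hpos le_rfl hu hv hM γ.2 hγu hδv
    (h.det_mul_sub_mul_eq_zero hlim hspecial hw hwfin le_rfl hu hv hγ hδ hγu hδv)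

end BadWord

end LimitWords

section Counterexamples

theorem distInt_nonneg (y : ℝ) : 0 ≤ distInt y := abs_nonneg _

theorem distInt_natAbs_mul_le (x : ℝ) (Q P : ℤ) : distInt ((Q.natAbs : ℝ) * x) ≤ |Q * x - P| := by
  rw [Nat.cast_natAbs, Int.cast_abs]
  rcases abs_choice (Q : ℝ) with h | h <;> rw [h]
  · exact round_le _ P
  · refine (round_le _ (-P)).trans_eq ?_
    rw [← abs_neg, Int.cast_neg]
    congr 1
    ring

namespace IsCounterexample

variable {p : ℕ} [hp : Fact p.Prime] {x : ℝ}

theorem eventually_le (hx : IsCounterexample p x) :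
    ∃ c > 0, ∀ᶠ q : ℕ in atTop, c ≤ (q : ℝ) * ‖(q : ℚ_[p])‖ * distInt ((q : ℝ) * x) := by
  set f : ℕ → ℝ := fun q => (q : ℝ) * ‖(q : ℚ_[p])‖ * distInt ((q : ℝ) * x)
  have hf : ∀ q, 0 ≤ f q := fun q =>
    mul_nonneg (mul_nonneg (Nat.cast_nonneg _) (norm_nonneg _)) (distInt_nonneg _)
  have hsSup : sSup {c | ∀ᶠ q in atTop, c ≤ f q} ≠ 0 := by
    rw [← liminf_eq]
    exact hx
  have hzero : (0 : ℝ) ∈ {c | ∀ᶠ q in atTop, c ≤ f q} := Eventually.of_forall hf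
  have hbdd : BddAbove {c | ∀ᶠ q in atTop, c ≤ f q} := by
    by_contra h
    exact hsSup (Real.sSup_of_not_bddAbove h)
  obtain ⟨c, hc, hpos⟩ := exists_lt_of_lt_csSup ⟨0, hzero⟩
    ((le_csSup hbdd hzero).lt_of_ne' hsSup)
  exact ⟨c, hpos, hc⟩

theorem irrational (hx : IsCounterexample p x) : Irrational x := by
  obtain ⟨c, hc, h⟩ := hx.eventually_le
  rintro ⟨r, rfl⟩
  obtain ⟨N, hN⟩ := eventually_atTop.mp h
  have hmul : ((r.den * (N + 1) : ℕ) : ℝ) * (r : ℝ) = ((r.num * (N + 1) : ℤ) : ℝ) := by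
    have : (r.den : ℝ) * (r : ℝ) = r.num := by exact_mod_cast Rat.den_mul_eq_num r
    push_cast
    linear_combination ((N : ℝ) + 1) * this
  have hle := hN (r.den * (N + 1)) (by nlinarith [r.den_pos])
  rw [hmul, distInt, round_intCast, sub_self, abs_zero, mul_zero] at hle
  linarith

theorem exists_le (hx : IsCounterexample p x) :
    ∃ c > 0, ∀ q : ℕ, 1 ≤ q → c ≤ (q : ℝ) * ‖(q : ℚ_[p])‖ * distInt ((q : ℝ) * x) := by
  obtain ⟨c, hc, h⟩ := hx.eventually_le
  obtain ⟨N, hN⟩ := eventually_atTop.mp h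
  have hpos : ∀ q : ℕ, 1 ≤ q → 0 < (q : ℝ) * ‖(q : ℚ_[p])‖ * distInt ((q : ℝ) * x) := by
    intro q hq
    have hq0 : q ≠ 0 := Nat.one_le_iff_ne_zero.mp hq
    refine mul_pos (mul_pos (by exact_mod_cast hq) (norm_pos_iff.mpr (by exact_mod_cast hq0)))
      (abs_pos.mpr (sub_ne_zero.mpr ?_))
    exact (hx.irrational.natCast_mul hq0).ne_int _
  have hsmall : ∀ᶠ c' in 𝓝[>] (0 : ℝ), ∀ q ∈ Finset.Ico 1 N,
      c' ≤ (q : ℝ) * ‖(q : ℚ_[p])‖ * distInt ((q : ℝ) * x) :=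
    (eventually_all_finset _).mpr fun q hq =>
      mem_of_superset (Ioc_mem_nhdsGT (hpos q (Finset.mem_Ico.mp hq).1)) fun _ h => h.2
  obtain ⟨c', hc', hc'0, hc'c⟩ := (hsmall.and (Ioc_mem_nhdsGT hc)).exists
  refine ⟨c', hc'0, fun q hq => ?_⟩
  rcases lt_or_ge q N with hlt | hge
  · exact hc' q (Finset.mem_Ico.mpr ⟨hq, hlt⟩)
  · exact hc'c.trans (hN q hge)

theorem exists_mul_pow_le (hx : IsCounterexample p x) :
    ∃ c > 0, ∀ (Q P : ℤ) (K : ℕ), Q ≠ 0 → (p : ℤ) ^ K ∣ Q →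
      c * (p : ℝ) ^ K ≤ |(Q : ℝ)| * |Q * x - P| := by
  obtain ⟨c, hc, hle⟩ := hx.exists_le
  refine ⟨c, hc, fun Q P K hQ hdvd => ?_⟩
  have hpK : (0 : ℝ) < (p : ℝ) ^ K := pow_pos (by exact_mod_cast hp.out.pos) K
  have hnorm : ‖(Q.natAbs : ℚ_[p])‖ ≤ ((p : ℝ) ^ K)⁻¹ := by
    rw [← zpow_natCast, ← zpow_neg, ← Int.cast_natCast Q.natAbs,
      Padic.norm_int_le_pow_iff_dvd, Int.dvd_natAbs]
    exact_mod_cast hdvd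
  rw [← le_div_iff₀ hpK]
  calc c ≤ (Q.natAbs : ℝ) * ‖(Q.natAbs : ℚ_[p])‖ * distInt ((Q.natAbs : ℝ) * x) :=
        hle _ (Int.natAbs_pos.mpr hQ)
    _ ≤ (Q.natAbs : ℝ) * ((p : ℝ) ^ K)⁻¹ * |Q * x - P| := by
        gcongr
        · exact distInt_nonneg _
        · exact distInt_natAbs_mul_le x Q P
    _ = |(Q : ℝ)| * |Q * x - P| / (p : ℝ) ^ K := by
        rw [Nat.cast_natAbs, Int.cast_abs]
        ring

end IsCounterexample

end Counterexamples

section ContinuedFractions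

open Matrix

variable {x : ℝ}

theorem not_terminatedAt_of_irrational (hx : Irrational x) (n : ℕ) :
    ¬ (GenContFract.of x).TerminatedAt n := fun h => by
  obtain ⟨q, hq⟩ := (GenContFract.terminates_iff_rat x).mp ⟨n, h⟩
  exact hx ⟨q, hq.symm⟩

theorem get?_of_irrational (hx : Irrational x) (n : ℕ) :
    (GenContFract.of x).s.get? n = some ⟨1, (cfWord x n : ℝ)⟩ ∧ 1 ≤ cfWord x n := by
  obtain ⟨⟨α, β⟩, hs⟩ : ∃ gp, (GenContFract.of x).s.get? n = some gp :=
    Option.ne_none_iff_exists'.mp (not_terminatedAt_of_irrational hx n)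
  have hden : (GenContFract.of x).partDens.get? n = some β := GenContFract.partDen_eq_s_b hs
  obtain ⟨rfl, m, rfl⟩ : α = 1 ∧ ∃ m : ℤ, β = m :=
    GenContFract.of_partNum_eq_one_and_exists_int_partDen_eq hs
  have hm : 1 ≤ m := by exact_mod_cast GenContFract.of_one_le_get?_partDen hden
  have hcf : (cfWord x n : ℤ) = m := by
    rw [cfWord, hden, Option.getD_some, ← Int.floor_toNat, Int.floor_intCast,
      Int.toNat_of_nonneg (by omega)]
  have hcfR : (cfWord x n : ℝ) = m := by exact_mod_cast hcf
  exact ⟨by rw [hs, hcfR], by omega⟩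

theorem one_le_cfWord (hx : Irrational x) (n : ℕ) : 1 ≤ cfWord x n := (get?_of_irrational hx n).2

theorem dens_eq_denVec (hx : Irrational x) (n : ℕ) :
    (GenContFract.of x).dens n = denVec (cfWord x) n 0 := by
  induction n using Nat.twoStepInduction with
  | zero => simp [denVec_zero]
  | one =>
    rw [GenContFract.first_den_eq (get?_of_irrational hx 0).1, denVec_succ, denVec_zero]
    simp
  | more n ih ih' =>
    rw [GenContFract.dens_recurrence (get?_of_irrational hx (n + 1)).1 ih ih',
      denVec_succ _ (n + 1), denVec_succ_one]
    simp

theorem exists_int_eq_nums (hx : Irrational x) (n : ℕ) :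
    ∃ P : ℤ, (GenContFract.of x).nums n = P := by
  induction n using Nat.twoStepInduction with
  | zero => exact ⟨⌊x⌋, by simp [GenContFract.of_h_eq_floor]⟩
  | one =>
    rw [GenContFract.first_num_eq (get?_of_irrational hx 0).1, GenContFract.of_h_eq_floor]
    exact ⟨cfWord x 0 * ⌊x⌋ + 1, by push_cast; ring⟩
  | more n ih ih' =>
    obtain ⟨P, hP⟩ := ih
    obtain ⟨P', hP'⟩ := ih'
    rw [GenContFract.nums_recurrence (get?_of_irrational hx (n + 1)).1 hP hP']
    exact ⟨cfWord x (n + 1) * P' + P, by push_cast; ring⟩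

theorem exists_abs_denVec_mul_sub_le (hx : Irrational x) (n : ℕ) :
    ∃ P : ℤ, |(denVec (cfWord x) n 0 : ℝ) * x - P| ≤ 1 / denVec (cfWord x) (n + 1) 0 := by
  have hpos : (0 : ℝ) < denVec (cfWord x) n 0 := by
    exact_mod_cast (denVec_bounds (one_le_cfWord hx) n).1
  obtain ⟨P, hP⟩ := exists_int_eq_nums hx n
  have hconv := GenContFract.abs_sub_convs_le (not_terminatedAt_of_irrational hx n)
  rw [GenContFract.conv_eq_num_div_den, hP, dens_eq_denVec hx, dens_eq_denVec hx] at hconv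
  refine ⟨P, ?_⟩
  calc |(denVec (cfWord x) n 0 : ℝ) * x - P|
      = denVec (cfWord x) n 0 * |x - P / denVec (cfWord x) n 0| := by
        rw [← abs_of_pos hpos, ← abs_mul, abs_of_pos hpos, mul_sub, mul_div_cancel₀ _ hpos.ne']
    _ ≤ denVec (cfWord x) n 0 *
          (1 / (denVec (cfWord x) n 0 * denVec (cfWord x) (n + 1) 0)) := by gcongr
    _ = 1 / denVec (cfWord x) (n + 1) 0 := by
        rw [mul_one_div, div_mul_cancel_left₀ hpos.ne', one_div]

theorem exists_abs_dotProduct_mul_sub_le (hx : Irrational x) (n : ℕ) (z : Fin 2 → ℤ) :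
    ∃ P : ℤ, |((denVec (cfWord x) n ⬝ᵥ z : ℤ) : ℝ) * x - P| ≤
      l1Norm z / denVec (cfWord x) n 0 := by
  have hpos : (0 : ℝ) < denVec (cfWord x) n 0 := by
    exact_mod_cast (denVec_bounds (one_le_cfWord hx) n).1
  have hcoord : ∀ i, ∃ P : ℤ,
      |(denVec (cfWord x) n i : ℝ) * x - P| ≤ 1 / denVec (cfWord x) n 0 := by
    refine Fin.forall_fin_two.mpr ⟨?_, ?_⟩
    · obtain ⟨P, hP⟩ := exists_abs_denVec_mul_sub_le hx n
      have hle := (denVec_bounds (one_le_cfWord hx) (n + 1)).2.2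
      rw [denVec_succ_one] at hle
      exact ⟨P, hP.trans (one_div_le_one_div_of_le hpos (by exact_mod_cast hle))⟩
    · cases n with
      | zero => exact ⟨0, by simp [denVec_zero]⟩
      | succ n =>
        rw [denVec_succ_one]
        exact exists_abs_denVec_mul_sub_le hx n
  choose P hP using hcoord
  refine ⟨P ⬝ᵥ z, ?_⟩
  calc |((denVec (cfWord x) n ⬝ᵥ z : ℤ) : ℝ) * x - (P ⬝ᵥ z : ℤ)|
      = |z 0 * (denVec (cfWord x) n 0 * x - P 0) + z 1 * (denVec (cfWord x) n 1 * x - P 1)| := by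
        simp only [dotProduct, Fin.sum_univ_two]
        push_cast
        congr 1
        ring
    _ ≤ |(z 0 : ℝ)| * (1 / denVec (cfWord x) n 0) + |(z 1 : ℝ)| * (1 / denVec (cfWord x) n 0) := by
        refine (abs_add_le _ _).trans ?_
        rw [abs_mul, abs_mul]
        gcongr <;> exact hP _
    _ = l1Norm z / denVec (cfWord x) n 0 := by
        rw [l1Norm]
        push_cast
        ring

namespace IsCounterexample

variable {p : ℕ} [hp : Fact p.Prime]

theorem exists_badWord (hx : IsCounterexample p x) : ∃ c, BadWord p (cfWord x) c := by
  have hirr := hx.irrational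
  obtain ⟨c, hc, hbad⟩ := hx.exists_mul_pow_le
  refine ⟨c, one_le_cfWord hirr, hc, fun n z K hne hdvd => ?_⟩
  obtain ⟨P, hP⟩ := exists_abs_dotProduct_mul_sub_le hirr n z
  have hpos : (0 : ℝ) < denVec (cfWord x) n 0 := by
    exact_mod_cast (denVec_bounds (one_le_cfWord hirr) n).1
  have hsize : |((denVec (cfWord x) n ⬝ᵥ z : ℤ) : ℝ)| ≤ denVec (cfWord x) n 0 * l1Norm z := by
    exact_mod_cast abs_denVec_dotProduct_le (one_le_cfWord hirr) n z
  calc c * (p : ℝ) ^ K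
      ≤ |((denVec (cfWord x) n ⬝ᵥ z : ℤ) : ℝ)| * |(denVec (cfWord x) n ⬝ᵥ z : ℤ) * x - P| :=
        hbad _ P K hne hdvd
    _ ≤ denVec (cfWord x) n 0 * l1Norm z * (l1Norm z / denVec (cfWord x) n 0) :=
        mul_le_mul hsize hP (abs_nonneg _) ((abs_nonneg _).trans hsize)
    _ = (l1Norm z : ℝ) ^ 2 := by field_simp

theorem finite_range_cfWord (hx : IsCounterexample p x) : (Set.range (cfWord x)).Finite := by
  have hirr := hx.irrational
  obtain ⟨c, hc, hbad⟩ := hx.exists_mul_pow_le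
  refine (Set.finite_Iic ⌊1 / c⌋₊).subset ?_
  rintro _ ⟨n, rfl⟩
  obtain ⟨h0, h1, -⟩ := denVec_bounds (one_le_cfWord hirr) n
  have h0R : (0 : ℝ) < denVec (cfWord x) n 0 := by exact_mod_cast h0
  have h0R' : (0 : ℝ) < denVec (cfWord x) (n + 1) 0 := by
    exact_mod_cast (denVec_bounds (one_le_cfWord hirr) (n + 1)).1
  obtain ⟨P, hP⟩ := exists_abs_denVec_mul_sub_le hirr n
  have hle : c ≤ denVec (cfWord x) n 0 * (1 / denVec (cfWord x) (n + 1) 0) := by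
    have h := hbad (denVec (cfWord x) n 0) P 0 h0.ne' (one_dvd _)
    rw [pow_zero, mul_one, abs_of_pos h0R] at h
    exact h.trans (mul_le_mul_of_nonneg_left hP h0R.le)
  rw [mul_one_div, le_div_iff₀ h0R'] at hle
  have hgrowth : (cfWord x n : ℝ) * denVec (cfWord x) n 0 ≤ denVec (cfWord x) (n + 1) 0 := by
    rw [denVec_succ]
    exact_mod_cast le_add_of_nonneg_right h1
  refine Nat.le_floor ((le_div_iff₀ hc).mpr (le_of_mul_le_mul_right ?_ h0R))
  linarith [mul_le_mul_of_nonneg_left hgrowth hc.le]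

end IsCounterexample

theorem isLimitWord_of_mem_limitWords {w : ℕ → ℕ} (hw : w ∈ limitWords x) :
    IsLimitWord (cfWord x) w := by
  intro L
  have hmem : {v : ℕ → ℕ | ∀ k < L, v k = w k} ∈ 𝓝 w :=
    set_pi_mem_nhds (Set.finite_Iio L) fun k _ => (isOpen_discrete {w k}).mem_nhds rfl
  exact mapClusterPt_iff_frequently.mp hw _ hmem

end ContinuedFractions

end PLC

theorem mainTheorem3 (p : ℕ) [Fact p.Prime] (x : ℝ) (hx : PLC.IsCounterexample p x) :
    (∀ w ∈ PLC.limitWords x,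
      Tendsto (fun n : ℕ => (PLC.complexity w n : ℤ) - (n : ℤ)) atTop atTop) ∧
    (∀ w ∈ PLC.limitWords x, ¬ PLC.IsSturmian w) := by
  have hlimit : ∀ w ∈ PLC.limitWords x,
      Tendsto (fun n : ℕ => (PLC.complexity w n : ℤ) - (n : ℤ)) atTop atTop := by
    intro w hw
    obtain ⟨c, hbad⟩ := hx.exists_badWord
    exact hbad.tendsto_complexity hx.finite_range_cfWord (PLC.isLimitWord_of_mem_limitWords hw)
  refine ⟨hlimit, fun w hw hsturmian => ?_⟩
  obtain ⟨n, hn⟩ := ((hlimit w hw).eventually_ge_atTop 2).exists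
  rw [hsturmian n] at hn
  push_cast at hn
  omega
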